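/- Let $D$ be a digraph on $[n]=\{1,\dots,n\}$, i.e. a set of directed edges $E\subseteq[n]\times[n]$ (loops allowed), and let $\overline D$ be its complement, with edge set $([n]\times[n])\setminus E$. A path-cycle cover $S$ of $D$ is a set of vertex-disjoint directed paths (single vertices allowed) and directed cycles (loops allowed) in $D$ that together contain every vertex; $\mathrm{path}(S)$ and $\mathrm{cycle}(S)$ are the partitions formed by the numbers of vertices of its paths and of its cycles. Let $\Lambda$ be the ring of symmetric functions over $\mathbb{Q}$, with monomial, elementary, complete homogeneous and power sum symmetric functions $m_\lambda,e_k,h_k,p_\lambda$, let $\tilde m_\lambda=r_1!\,r_2!\cdots m_\lambda$, where $r_i$ is the number of parts of $\lambda$ equal to $i$, and let $\omega:\Lambda\to\Lambda$ be the algebra homomorphism with $\omega(e_k)=h_k$ for all $k\ge1$. For two sets of variables $\vec z=(z_1,z_2,\dots)$ and $\vec y=(y_1,y_2,\dots)$, Chow's path-cycle symmetric function is $$\Xi_D(\vec z,\vec y)=\sum_S \tilde m_{\mathrm{path}(S)}(\vec z)\,p_{\mathrm{cycle}(S)}(\vec y)\in\Lambda_{\vec z}\otimes\Lambda_{\vec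 y},$$ the sum being over all path-cycle covers $S$ of $D$. Let $\omega_{\vec z}$ be $\omega$ acting on the $\vec z$ variables only, let $-\vec y=(-y_1,-y_2,\dots)$, and let $[\,\cdot\,]_{\vec z\to(\vec z,\vec y)}$ denote the replacement of the set of variables $\vec z$ by the union of the variables $\vec z$ and $\vec y$. Then $$\big[\omega_{\vec z}\,\Xi_{\overline D}(\vec z,-\vec y)\big]_{\vec z\to(\vec z,\vec y)}=\Xi_D(\vec z,\vec y).$$ -/

import Mathlib

noncomputable section

open scoped TensorProduct

namespace ChowPC

/-! ### The ring of symmetric functions over `ℚ` in countably many variables -/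

/-- The ring `Λ` of symmetric functions over `ℚ`: formal power series of bounded degree in the
variables indexed by `ℕ` that are invariant under all permutations of the variables. -/
def SymFun : Subalgebra ℚ (MvPowerSeries ℕ ℚ) where
  carrier := {f | (∀ σ : Equiv.Perm ℕ, MvPowerSeries.rename σ f = f) ∧
    ∃ N : ℕ, ∀ d : ℕ →₀ ℕ, N < d.degree → MvPowerSeries.coeff d f = 0}
  mul_mem' := by
    classical
    rintro f g ⟨hf, M, hM⟩ ⟨hg, N, hN⟩
    refine ⟨fun σ => by rw [map_mul, hf, hg], M + N, fun d hd => ?_⟩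
    rw [MvPowerSeries.coeff_mul]
    refine Finset.sum_eq_zero fun x hx => ?_
    rw [Finset.HasAntidiagonal.mem_antidiagonal] at hx
    have h : x.1.degree + x.2.degree = d.degree := by rw [← hx, map_add]
    rcases lt_or_ge M x.1.degree with h1 | h1
    · rw [hM _ h1, zero_mul]
    · rw [hN _ (by omega), mul_zero]
  add_mem' := by
    rintro f g ⟨hf, M, hM⟩ ⟨hg, N, hN⟩
    refine ⟨fun σ => by rw [map_add, hf, hg], M + N, fun d hd => ?_⟩
    rw [map_add, hM _ (by omega), hN _ (by omega), add_zero]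
  algebraMap_mem' r := by
    refine ⟨fun σ => AlgHom.commutes _ r, 0, fun d hd => ?_⟩
    classical
    have hd0 : d ≠ 0 := by rintro rfl; simp at hd
    rw [MvPowerSeries.algebraMap_apply, MvPowerSeries.coeff_C, if_neg hd0]

/-- The multiset of nonzero exponents of a monomial. -/
def parts (d : ℕ →₀ ℕ) : Multiset ℕ := d.support.val.map d

lemma sum_parts (d : ℕ →₀ ℕ) : (parts d).sum = d.degree := rfl

lemma parts_mapDomain (σ : Equiv.Perm ℕ) (d : ℕ →₀ ℕ) : parts (d.mapDomain σ) = parts d := by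
  have : d.mapDomain σ = d.embDomain σ.toEmbedding := by
    rw [Finsupp.embDomain_eq_mapDomain]; rfl
  rw [this, parts, parts, Finsupp.support_embDomain, Finset.map_val, Multiset.map_map]
  refine Multiset.map_congr rfl fun x _ => ?_
  exact Finsupp.embDomain_apply_self σ.toEmbedding d x

lemma coeff_mapDomain_rename (σ : Equiv.Perm ℕ) (f : MvPowerSeries ℕ ℚ) (d : ℕ →₀ ℕ) :
    MvPowerSeries.coeff (d.mapDomain σ) (MvPowerSeries.rename σ f) = MvPowerSeries.coeff d f := by
  have h := MvPowerSeries.coeff_embDomain_rename σ.toEmbedding f d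
  rw [Finsupp.embDomain_eq_mapDomain] at h
  exact h

lemma rename_eq_iff (σ : Equiv.Perm ℕ) (f : MvPowerSeries ℕ ℚ) :
    MvPowerSeries.rename σ f = f ↔
      ∀ d, MvPowerSeries.coeff (d.mapDomain σ) f = MvPowerSeries.coeff d f := by
  constructor
  · intro h d
    conv_lhs => rw [← h]
    exact coeff_mapDomain_rename σ f d
  · intro h
    ext d
    have hd : (d.mapDomain σ.symm).mapDomain σ = d := by
      rw [← Finsupp.mapDomain_comp]; simp
    rw [← hd, coeff_mapDomain_rename, h]

lemma mem_symFun_of_parts {f : MvPowerSeries ℕ ℚ} (N : ℕ)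
    (h : ∀ d d', parts d = parts d' → MvPowerSeries.coeff d f = MvPowerSeries.coeff d' f)
    (hN : ∀ d : ℕ →₀ ℕ, N < d.degree → MvPowerSeries.coeff d f = 0) : f ∈ SymFun :=
  ⟨fun σ => (rename_eq_iff σ f).2 fun d => h _ _ (parts_mapDomain σ d), N, hN⟩

/-- The monomial symmetric function `m_μ` of a partition `μ` (a multiset of positive integers):
the sum of all distinct monomials whose multiset of nonzero exponents is `μ`. -/
def mSym (μ : Multiset ℕ) : SymFun :=
  ⟨fun d => if parts d = μ then 1 else 0, by
    refine mem_symFun_of_parts μ.sum (fun d d' h => ?_) fun d hd => ?_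
    · change (if parts d = μ then (1 : ℚ) else 0) = if parts d' = μ then 1 else 0
      rw [h]
    · change (if parts d = μ then (1 : ℚ) else 0) = 0
      refine if_neg ?_
      rintro rfl
      exact absurd hd (by rw [sum_parts]; exact lt_irrefl _)⟩

/-- The elementary symmetric function `e_k`. -/
def eSym (k : ℕ) : SymFun := mSym (Multiset.replicate k 1)

/-- The complete homogeneous symmetric function `h_k`: the sum of all monomials of degree `k`. -/
def hSym (k : ℕ) : SymFun :=
  ⟨fun d => if d.degree = k then 1 else 0, by
    refine mem_symFun_of_parts k (fun d d' h => ?_) fun d hd => ?_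
    · change (if d.degree = k then (1 : ℚ) else 0) = if d'.degree = k then 1 else 0
      rw [← sum_parts, ← sum_parts, h]
    · exact if_neg hd.ne'⟩

/-- The power sum symmetric function `p_k` for `k ≥ 1`. -/
def pSym (k : ℕ) : SymFun := mSym {k}

/-- The power sum symmetric function `p_μ = p_{μ₁} p_{μ₂} ⋯` of a partition `μ`. -/
def pSymPart (μ : Multiset ℕ) : SymFun := (μ.map pSym).prod

/-- The augmented monomial symmetric function `r₁! r₂! ⋯ m_μ`, where `r_i` is the number of parts
of `μ` equal to `i`. -/
def augmentedMSym (μ : Multiset ℕ) : SymFun :=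
  ((∏ i ∈ μ.toFinset, (μ.count i).factorial : ℕ) : ℚ) • mSym μ

/-! ### The fundamental involution -/

/-- The algebra homomorphism `ℚ[X₀, X₁, …] → Λ` with `X_i ↦ e_{i+1}`. -/
def eHom : MvPolynomial ℕ ℚ →ₐ[ℚ] SymFun := MvPolynomial.aeval fun i => eSym (i + 1)

/-- Setting all variables of index at least `N` to zero. -/
def cut (N : ℕ) : SymFun →ₐ[ℚ] MvPowerSeries (Fin N) ℚ :=
  (MvPowerSeries.killCompl Fin.valEmbedding).comp SymFun.val

lemma coeff_cut (N : ℕ) (f : SymFun) (x : Fin N →₀ ℕ) :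
    MvPowerSeries.coeff x (cut N f) =
      MvPowerSeries.coeff (x.embDomain Fin.valEmbedding) (f : MvPowerSeries ℕ ℚ) :=
  MvPowerSeries.coeff_killCompl _ _

lemma cut_eSym (N k : ℕ) :
    cut N (eSym k) = ((MvPolynomial.esymm (Fin N) ℚ k : MvPolynomial (Fin N) ℚ) :
      MvPowerSeries (Fin N) ℚ) := by
  ext x
  rw [coeff_cut, MvPolynomial.coeff_coe, MvPolynomial.esymm_eq_sum_monomial,
    MvPolynomial.coeff_sum]
  simp only [MvPolynomial.coeff_monomial]
  have key : ∀ t : Finset (Fin N), (∑ i ∈ t, Finsupp.single i 1 : Fin N →₀ ℕ) = x ↔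
      (x.support = t ∧ ∀ i ∈ t, x i = 1) := by
    intro t
    have hs : ∀ j, (∑ i ∈ t, Finsupp.single i 1 : Fin N →₀ ℕ) j = if j ∈ t then 1 else 0 := by
      intro j
      simp [Finsupp.finsetSum_apply, Finsupp.single_apply]
    constructor
    · rintro rfl
      refine ⟨?_, fun i hi => by rw [hs, if_pos hi]⟩
      ext j
      rw [Finsupp.mem_support_iff, hs]
      simp
    · rintro ⟨h1, h2⟩
      ext j
      rw [hs]
      split_ifs with hj
      · exact (h2 j hj).symm
      · rw [← h1, Finsupp.notMem_support_iff] at hj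
        exact hj.symm
  have hp : parts (x.embDomain Fin.valEmbedding) = x.support.val.map x := by
    rw [parts, Finsupp.support_embDomain, Finset.map_val, Multiset.map_map]
    exact Multiset.map_congr rfl fun i _ => Finsupp.embDomain_apply_self _ x i
  have hl : MvPowerSeries.coeff (x.embDomain Fin.valEmbedding) (eSym k : MvPowerSeries ℕ ℚ) =
      if parts (x.embDomain Fin.valEmbedding) = Multiset.replicate k 1 then 1 else 0 := rfl
  rw [hl, hp]
  simp only [key]
  have hiff : x.support.val.map x = Multiset.replicate k 1 ↔
      x.support.card = k ∧ ∀ i ∈ x.support, x i = 1 := by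
    rw [Multiset.eq_replicate]
    simp
  by_cases h : x.support.card = k ∧ ∀ i ∈ x.support, x i = 1
  · rw [if_pos (hiff.2 h)]
    rw [Finset.sum_eq_single x.support]
    · rw [if_pos ⟨rfl, h.2⟩]
    · intro t _ ht
      rw [if_neg]
      rintro ⟨h1, _⟩
      exact ht h1.symm
    · intro hn
      exact absurd (Finset.mem_powersetCard.2 ⟨Finset.subset_univ _, h.1⟩) hn
  · rw [if_neg (mt hiff.1 h)]
    symm
    refine Finset.sum_eq_zero fun t ht => if_neg ?_
    rintro ⟨h1, h2⟩
    subst h1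
    exact h ⟨(Finset.mem_powersetCard.1 ht).2, h2⟩

lemma cut_eHom_rename (N : ℕ) (p : MvPolynomial (Fin N) ℚ) :
    cut N (eHom (MvPolynomial.rename Fin.val p)) =
      (((MvPolynomial.esymmAlgHom (Fin N) ℚ N p : MvPolynomial.symmetricSubalgebra (Fin N) ℚ) :
        MvPolynomial (Fin N) ℚ) : MvPowerSeries (Fin N) ℚ) := by
  have h : ((cut N).comp eHom).comp (MvPolynomial.rename Fin.val) =
      ((MvPolynomial.coeToMvPowerSeries.algHom ℚ).comp
        (MvPolynomial.symmetricSubalgebra (Fin N) ℚ).val).comp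
          (MvPolynomial.esymmAlgHom (Fin N) ℚ N) := by
    refine MvPolynomial.algHom_ext fun i => ?_
    simp [eHom, cut_eSym, MvPolynomial.esymmAlgHom]
  have := DFunLike.congr_fun h p
  simpa using this

lemma eHom_injective : Function.Injective eHom := by
  rw [injective_iff_map_eq_zero]
  intro p hp
  obtain ⟨N, q, rfl⟩ : ∃ N, ∃ q : MvPolynomial (Fin N) ℚ, p = MvPolynomial.rename Fin.val q := by
    refine ⟨p.vars.sup id + 1, ?_⟩
    obtain ⟨q, hq⟩ := MvPolynomial.exists_rename_eq_of_vars_subset_range p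
      (Fin.val : Fin (p.vars.sup id + 1) → ℕ) Fin.val_injective fun i hi =>
        ⟨⟨i, Nat.lt_succ_of_le (Finset.le_sup (f := id) hi)⟩, rfl⟩
    exact ⟨q, hq.symm⟩
  have h := cut_eHom_rename N q
  rw [hp, map_zero] at h
  have h1 : ((MvPolynomial.esymmAlgHom (Fin N) ℚ N q :
      MvPolynomial.symmetricSubalgebra (Fin N) ℚ) : MvPolynomial (Fin N) ℚ) = 0 := by
    apply MvPolynomial.coe_injective
    rw [← h]; simp
  have h2 : MvPolynomial.esymmAlgHom (Fin N) ℚ N q = 0 := Subtype.ext h1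
  have h3 : q = 0 := MvPolynomial.esymmAlgHom_fin_injective ℚ le_rfl (by rw [h2, map_zero])
  rw [h3, map_zero]

/-- A symmetric function of degree at most `N` is determined by its restriction to `N`
variables. -/
lemma eq_zero_of_cut {N : ℕ} {f : SymFun} (h : cut N f = 0) (d : ℕ →₀ ℕ) (hd : d.degree ≤ N) :
    MvPowerSeries.coeff d (f : MvPowerSeries ℕ ℚ) = 0 := by
  have hc : d.support.card ≤ N := by
    refine le_trans ?_ hd
    rw [Finsupp.degree, Finset.card_eq_sum_ones]
    exact Finset.sum_le_sum fun i hi => Nat.one_le_iff_ne_zero.2 (Finsupp.mem_support_iff.1 hi)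
  obtain ⟨σ, hσ⟩ : ∃ σ : Equiv.Perm ℕ, ∀ i ∈ d.support, σ i < N := by
    have := Equiv.Perm.isMultiplyPretransitive ℕ d.support.card
    obtain ⟨g, hg⟩ := this.exists_smul_eq (d.support.orderEmbOfFin rfl).toEmbedding
      Fin.valEmbedding
    refine ⟨g, fun i hi => ?_⟩
    have : i ∈ Set.range (d.support.orderEmbOfFin rfl) := by
      rw [Finset.range_orderEmbOfFin]; exact hi
    obtain ⟨j, rfl⟩ := this
    have h2 := DFunLike.congr_fun hg j
    have h3 : g (d.support.orderEmbOfFin rfl j) = j.val := h2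
    rw [h3]
    exact lt_of_lt_of_le j.2 hc
  have h1 := (rename_eq_iff σ f).1 (f.2.1 σ) d
  rw [← h1]
  have hr : d.mapDomain σ ∈ Set.range (Finsupp.embDomain (M := ℕ) (Fin.valEmbedding (n := N))) := by
    rw [Finsupp.mem_range_embDomain_iff]
    intro j hj
    have := Finsupp.mapDomain_support hj
    obtain ⟨i, hi, rfl⟩ := Finset.mem_image.1 this
    exact ⟨⟨σ i, hσ i hi⟩, rfl⟩
  obtain ⟨x, hx⟩ := hr
  rw [← hx, ← coeff_cut, h, map_zero]

lemma exists_cut_eq_coe {f : SymFun} (N : ℕ) :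
    ∃ p : MvPolynomial.symmetricSubalgebra (Fin N) ℚ,
      cut N f = ((p : MvPolynomial (Fin N) ℚ) : MvPowerSeries (Fin N) ℚ) := by
  obtain ⟨M, hM⟩ := f.2.2
  have hfin : {x : Fin N →₀ ℕ | x.degree ≤ M}.Finite := Finsupp.finite_of_degree_le M
  let p : MvPolynomial (Fin N) ℚ :=
    ∑ x ∈ hfin.toFinset, MvPolynomial.monomial x (MvPowerSeries.coeff x (cut N f))
  have hp : ∀ x, p.coeff x = MvPowerSeries.coeff x (cut N f) := by
    intro x
    simp only [p, MvPolynomial.coeff_sum, MvPolynomial.coeff_monomial, Finset.sum_ite_eq',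
      Set.Finite.mem_toFinset, Set.mem_ofPred_eq]
    split_ifs with h
    · rfl
    · rw [coeff_cut, hM]
      rw [← sum_parts, parts, Finsupp.support_embDomain, Finset.map_val, Multiset.map_map]
      have : (x.embDomain Fin.valEmbedding) ∘ (Fin.valEmbedding (n := N)) = x :=
        funext fun i => Finsupp.embDomain_apply_self _ x i
      rw [this]
      exact not_le.1 h
  refine ⟨⟨p, fun e => ?_⟩, ?_⟩
  · ext x
    obtain ⟨y, rfl⟩ : ∃ y, x = Finsupp.mapDomain e y := by
      refine ⟨x.mapDomain e.symm, ?_⟩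
      rw [← Finsupp.mapDomain_comp]; simp
    rw [MvPolynomial.coeff_rename_mapDomain _ e.injective, hp, hp, coeff_cut, coeff_cut]
    have h1 := (rename_eq_iff (e.viaEmbedding Fin.valEmbedding) f).1 (f.2.1 _)
      (y.embDomain Fin.valEmbedding)
    rw [← h1]
    congr 1
    rw [Finsupp.embDomain_eq_mapDomain, Finsupp.embDomain_eq_mapDomain, ← Finsupp.mapDomain_comp,
      ← Finsupp.mapDomain_comp]
    have : (e.viaEmbedding Fin.valEmbedding : ℕ → ℕ) ∘ (Fin.valEmbedding (n := N)) =
        Fin.valEmbedding ∘ e :=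
      funext fun i => Equiv.Perm.viaEmbedding_apply e Fin.valEmbedding i
    rw [this]
  · ext x
    rw [MvPolynomial.coeff_coe, hp]

lemma coeff_eHom_monomial (s : ℕ →₀ ℕ) (c : ℚ) (d : ℕ →₀ ℕ)
    (hd : d.degree ≠ Finsupp.weight (fun i => i + 1) s) :
    MvPowerSeries.coeff d (eHom (MvPolynomial.monomial s c) : MvPowerSeries ℕ ℚ) = 0 := by
  have he : ∀ k, (eSym k : MvPowerSeries ℕ ℚ).IsHomogeneous k := by
    intro k d hd
    have h : (if parts d = Multiset.replicate k 1 then (1 : ℚ) else 0) ≠ 0 := hd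
    have h1 : parts d = Multiset.replicate k 1 := by
      by_contra h2
      exact h (if_neg h2)
    have h3 : d.degree = k := by rw [← sum_parts, h1]; simp
    rw [Finsupp.degree_eq_weight_one] at h3
    exact h3
  have hh : ∀ s : ℕ →₀ ℕ, (eHom (MvPolynomial.monomial s 1) :
      MvPowerSeries ℕ ℚ).IsHomogeneous (Finsupp.weight (fun i => i + 1) s) := by
    intro s
    induction s using Finsupp.induction_linear with
    | zero =>
      intro d hd
      have h1 : (eHom (MvPolynomial.monomial 0 1) : MvPowerSeries ℕ ℚ) = 1 := by
        rw [MvPolynomial.monomial_zero', map_one, map_one]; rfl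
      rw [h1, MvPowerSeries.coeff_one] at hd
      have : d = 0 := by
        by_contra h2
        exact hd (if_neg h2)
      rw [this, map_zero, map_zero]
    | add s t hs ht =>
      have h1 : (MvPolynomial.monomial (s + t) (1 : ℚ)) =
          MvPolynomial.monomial s 1 * MvPolynomial.monomial t 1 := by
        rw [MvPolynomial.monomial_mul, one_mul]
      rw [h1, map_mul, map_add]
      intro d hd
      exact MvPowerSeries.IsHomogeneous.mul hs ht hd
    | single i m =>
      have h1 : (MvPolynomial.monomial (Finsupp.single i m) (1 : ℚ)) = MvPolynomial.X i ^ m := by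
        rw [MvPolynomial.X_pow_eq_monomial]
      rw [h1, map_pow, eHom, MvPolynomial.aeval_X, Finsupp.weight_single]
      induction m with
      | zero =>
        intro d hd
        have h1 : ((eSym (i + 1) ^ 0 : SymFun) : MvPowerSeries ℕ ℚ) = 1 := by
          rw [pow_zero]; rfl
        rw [h1, MvPowerSeries.coeff_one] at hd
        have : d = 0 := by
          by_contra h2
          exact hd (if_neg h2)
        rw [this, map_zero, zero_smul]
      | succ m ih =>
        rw [pow_succ, add_smul, one_smul]
        intro d hd
        exact MvPowerSeries.IsHomogeneous.mul (ih MvPolynomial.X_pow_eq_monomial.symm)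
          (he (i + 1)) hd
  have h1 : MvPolynomial.monomial s c = c • MvPolynomial.monomial s (1 : ℚ) := by
    rw [MvPolynomial.smul_monomial, smul_eq_mul, mul_one]
  rw [h1, map_smul]
  have h2 := MvPowerSeries.IsHomogeneous.coeff_eq_zero (hh s) hd
  change MvPowerSeries.coeff d
    (c • (eHom (MvPolynomial.monomial s 1) : MvPowerSeries ℕ ℚ)) = 0
  rw [map_smul, h2, smul_zero]

lemma eHom_surjective : Function.Surjective eHom := by
  intro f
  obtain ⟨N, hN⟩ := f.2.2
  obtain ⟨P, hP⟩ := exists_cut_eq_coe (f := f) N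
  obtain ⟨q, rfl⟩ := (MvPolynomial.esymmAlgHom_fin_bijective ℚ N).2 P
  rw [← cut_eHom_rename] at hP
  let p := MvPolynomial.rename Fin.val q
  let w : (ℕ →₀ ℕ) → ℕ := fun s => Finsupp.weight (fun i : ℕ => i + 1) s
  refine ⟨∑ s ∈ p.support with w s ≤ N, MvPolynomial.monomial s (p.coeff s), ?_⟩
  apply Subtype.ext
  ext d
  have hco : ∀ T : Finset (ℕ →₀ ℕ), MvPowerSeries.coeff d
      (eHom (∑ s ∈ T, MvPolynomial.monomial s (p.coeff s)) : MvPowerSeries ℕ ℚ) =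
      ∑ s ∈ T, MvPowerSeries.coeff d
        (eHom (MvPolynomial.monomial s (p.coeff s)) : MvPowerSeries ℕ ℚ) := by
    intro T
    rw [map_sum, AddSubmonoidClass.coe_finsetSum, map_sum]
  rw [hco]
  rcases lt_or_ge N d.degree with h | h
  · rw [hN d h]
    refine Finset.sum_eq_zero fun s hs => coeff_eHom_monomial _ _ _ ?_
    have := (Finset.mem_filter.1 hs).2
    intro h2
    rw [h2] at h
    exact absurd h (not_lt.2 this)
  · have h0 : cut N (eHom p - f) = 0 := by rw [map_sub, hP, sub_self]
    have h1 := eq_zero_of_cut h0 d h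
    have h2 : MvPowerSeries.coeff d (eHom p : MvPowerSeries ℕ ℚ) =
        MvPowerSeries.coeff d (f : MvPowerSeries ℕ ℚ) := by
      rw [← sub_eq_zero, ← map_sub]; exact h1
    rw [← h2]
    conv_rhs => rw [p.as_sum]
    rw [hco]
    refine Finset.sum_subset (Finset.filter_subset _ _) fun s hs hs' => ?_
    refine coeff_eHom_monomial _ _ _ fun h3 => hs' (Finset.mem_filter.2 ⟨hs, ?_⟩)
    rw [h3] at h
    exact h

/-- The fundamental theorem of symmetric functions: `Λ` is the polynomial ring in the `e_k`,
`k ≥ 1`. -/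
def eEquiv : MvPolynomial ℕ ℚ ≃ₐ[ℚ] SymFun :=
  AlgEquiv.ofBijective eHom ⟨eHom_injective, eHom_surjective⟩

/-- The fundamental involution `ω : Λ → Λ`, the algebra homomorphism with `e_k ↦ h_k` for all
`k ≥ 1`. -/
def omega : SymFun →ₐ[ℚ] SymFun :=
  (MvPolynomial.aeval fun i => hSym (i + 1)).comp eEquiv.symm.toAlgHom

lemma omega_eSym (k : ℕ) (hk : 1 ≤ k) : omega (eSym k) = hSym k := by
  obtain ⟨k, rfl⟩ := Nat.exists_eq_add_of_le' hk
  have h : eEquiv.symm (eSym (k + 1)) = MvPolynomial.X k := by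
    rw [AlgEquiv.symm_apply_eq]
    simp [eEquiv, eHom]
  simp [omega, h]

/-- The substitution `f(x₀, x₁, …) ↦ f(-x₀, -x₁, …)`. -/
def negVars : SymFun →ₐ[ℚ] SymFun :=
  ((MvPowerSeries.rescaleAlgHom fun _ : ℕ => (-1 : ℚ)).comp SymFun.val).codRestrict SymFun <| by
    have hc : ∀ (f : SymFun) (d : ℕ →₀ ℕ), MvPowerSeries.coeff d
        (((MvPowerSeries.rescaleAlgHom fun _ : ℕ => (-1 : ℚ)).comp SymFun.val) f) =
        (-1) ^ d.degree * MvPowerSeries.coeff d (f : MvPowerSeries ℕ ℚ) := by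
      intro f d
      rw [AlgHom.comp_apply, MvPowerSeries.rescaleAlgHom_apply, MvPowerSeries.coeff_rescale,
        Finsupp.prod, Finset.prod_pow_eq_pow_sum]
      rfl
    intro f
    obtain ⟨hs, N, hN⟩ := f.2
    refine ⟨fun σ => (rename_eq_iff σ _).2 fun d => ?_, N, fun d hd => ?_⟩
    · rw [hc, hc, (rename_eq_iff σ f).1 (hs σ) d, ← sum_parts, ← sum_parts, parts_mapDomain]
    · rw [hc, hN d hd, mul_zero]

/-! ### Two sets of variables

Elements of `Λ ⊗ Λ` are polynomial expressions in symmetric functions of `z = (z₀, z₁, …)` (first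
factor) and symmetric functions of `y = (y₀, y₁, …)` (second factor). In power series in the
variables `ℕ ⊕ ℕ`, the variable `z_i` is `X (Sum.inl i)` and `y_i` is `X (Sum.inr i)`. -/

/-- `f ↦ f(z)`. -/
def inZ : SymFun →ₐ[ℚ] MvPowerSeries (ℕ ⊕ ℕ) ℚ :=
  (MvPowerSeries.rename (Function.Embedding.inl : ℕ ↪ ℕ ⊕ ℕ)).comp SymFun.val

/-- `f ↦ f(y)`. -/
def inY : SymFun →ₐ[ℚ] MvPowerSeries (ℕ ⊕ ℕ) ℚ :=
  (MvPowerSeries.rename (Function.Embedding.inr : ℕ ↪ ℕ ⊕ ℕ)).comp SymFun.val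

/-- `f ↦ f(z, y)`, evaluation at the union of the two sets of variables. As `f` is symmetric, the
enumeration of the union does not matter. -/
def inZY : SymFun →ₐ[ℚ] MvPowerSeries (ℕ ⊕ ℕ) ℚ :=
  (MvPowerSeries.rename Equiv.natSumNatEquivNat.symm).comp SymFun.val

/-- The power series `F(z, y)` of `F ∈ Λ ⊗ Λ`. -/
def toSeries : SymFun ⊗[ℚ] SymFun →ₐ[ℚ] MvPowerSeries (ℕ ⊕ ℕ) ℚ :=
  Algebra.TensorProduct.productMap inZ inY

/-- The power series obtained from `F(z, y)`, `F ∈ Λ ⊗ Λ`, by replacing the set of variables `z`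
by the union of `z` and `y`, i.e. `f(z) g(y) ↦ f(z, y) g(y)`. -/
def replaceZByZY : SymFun ⊗[ℚ] SymFun →ₐ[ℚ] MvPowerSeries (ℕ ⊕ ℕ) ℚ :=
  Algebra.TensorProduct.productMap inZY inY

/-- The fundamental involution acting on the `z` variables only. -/
def omegaZ : SymFun ⊗[ℚ] SymFun →ₐ[ℚ] SymFun ⊗[ℚ] SymFun :=
  Algebra.TensorProduct.map omega (AlgHom.id ℚ SymFun)

/-- The substitution `F(z, y) ↦ F(z, -y)`. -/
def negY : SymFun ⊗[ℚ] SymFun →ₐ[ℚ] SymFun ⊗[ℚ] SymFun :=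
  Algebra.TensorProduct.map (AlgHom.id ℚ SymFun) negVars

/-! ### The path-cycle symmetric function of a digraph -/

variable {n : ℕ}

/-- A (directed) path in `D`: a nonempty sequence of distinct vertices, consecutive ones being
joined by a directed edge. -/
abbrev DiPath (D : Digraph (Fin n)) : Type :=
  {l : List (Fin n) // l.Nodup ∧ l ≠ [] ∧ l.IsChain D.Adj}

/-- A (directed) cycle in `D`: a nonempty sequence of distinct vertices up to cyclic shift, each
vertex being joined to its cyclic successor by a directed edge. A loop is a cycle with one
vertex. -/
abbrev DiCycle (D : Digraph (Fin n)) : Type :=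
  {c : Cycle (Fin n) // c.Nodup ∧ c ≠ Cycle.nil ∧ c.Chain D.Adj}

instance (D : Digraph (Fin n)) : Finite (DiPath D) :=
  Finite.of_injective (fun l => (⟨l.1, l.2.1⟩ : {l : List (Fin n) // l.Nodup}))
    fun _ _ h => Subtype.ext (Subtype.mk.inj h)

instance (D : Digraph (Fin n)) : Finite (DiCycle D) :=
  Finite.of_injective (fun c => (⟨c.1, c.2.1⟩ : {c : Cycle (Fin n) // c.Nodup}))
    fun _ _ h => Subtype.ext (Subtype.mk.inj h)

/-- A path-cycle cover of `D`: a set of paths and cycles in `D` such that every vertex of `D` lies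
in exactly one of them. -/
structure PathCycleCover (D : Digraph (Fin n)) where
  /-- the paths of the cover -/
  paths : Finset (DiPath D)
  /-- the cycles of the cover -/
  cycles : Finset (DiCycle D)
  /-- every vertex lies in exactly one of the paths and cycles -/
  covers : ∀ v : Fin n,
    (paths.filter fun l => v ∈ l.1).card + (cycles.filter fun c => v ∈ c.1).card = 1

instance (D : Digraph (Fin n)) : Finite (PathCycleCover D) :=
  Finite.of_injective (fun S => (S.paths, S.cycles)) fun S T h => by
    cases S; cases T; simp_all

instance (D : Digraph (Fin n)) : Fintype (PathCycleCover D) := Fintype.ofFinite _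

/-- The partition formed by the numbers of vertices of the paths of a cover. -/
def PathCycleCover.pathType {D : Digraph (Fin n)} (S : PathCycleCover D) : Multiset ℕ :=
  S.paths.val.map fun l => l.1.length

/-- The partition formed by the numbers of vertices of the cycles of a cover. -/
def PathCycleCover.cycleType {D : Digraph (Fin n)} (S : PathCycleCover D) : Multiset ℕ :=
  S.cycles.val.map fun c => c.1.length

/-- The path-cycle symmetric function `Ξ_D(z, y)` of a digraph `D`. -/
def Xi (D : Digraph (Fin n)) : SymFun ⊗[ℚ] SymFun :=
  ∑ S : PathCycleCover D, augmentedMSym S.pathType ⊗ₜ[ℚ] pSymPart S.cycleType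

end ChowPC

end

open scoped TensorProduct

namespace ChowPC

/-! ### Power sums -/

/-! The function `XiOn D X`, built from the covers of the induced subgraph on `X`, satisfies a
recursion (`XiOn_eq_sum`) that determines it: for any `v ∈ X` it is the sum over `B` with `v ∈ B ⊆
X` of `(d_B p_{|B|}(z) + c_B p_{|B|}(y)) · XiOn D (X \ B)`. Here `c_B` counts the cycles of `D` on
`B`, `c̄_B` those of the complement, and `d_B = c_B - (-1)^{|B|} c̄_B`.

Reciprocity is then a comparison of coefficients. For the complement, `d̄_B = -(-1)^{|B|} d_B`. With
`k = |B|`, the operations send `p_k(z)` to `(-1)^{k+1} (p_k(z) + p_k(y))` and `p_k(y)` to `(-1)^k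
p_k(y)`. The factor for the complement becomes `d_B p_k(z) + (d_B + (-1)^k c̄_B) p_k(y)`, which is
the factor for `D`; induction on `X` finishes.

The recursion comes from looking at the block containing `v`. A cycle splits off as a factor since
`p_μ` is multiplicative. For a path two facts are combined. Multiplying an augmented monomial
function by `p_k` adjoins a part `k` or adds `k` to an existing part (`pSym_mul_augmentedMSym`).
Hamiltonian path counts satisfy `ham(Y) = ∑ d_B ham(Y \ B)` over `v ∈ B ⊆ Y` (`hamCount_insert`):
the indicator of `D` and minus the indicator of its complement differ by the constant `1`, so a
product of weights along a walk telescopes. -/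

lemma coeff_mSym (μ : Multiset ℕ) (d : ℕ →₀ ℕ) :
    MvPowerSeries.coeff d (mSym μ : MvPowerSeries ℕ ℚ) = if parts d = μ then 1 else 0 := rfl

lemma coeff_hSym (k : ℕ) (d : ℕ →₀ ℕ) :
    MvPowerSeries.coeff d (hSym k : MvPowerSeries ℕ ℚ) = if d.degree = k then 1 else 0 := rfl

lemma parts_eq_singleton_iff {k : ℕ} (hk : k ≠ 0) (d : ℕ →₀ ℕ) :
    parts d = {k} ↔ ∃ i, d = Finsupp.single i k := by
  constructor
  · intro h
    have hc : d.support.card = 1 := by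
      have := congrArg Multiset.card h
      simpa [parts] using this
    obtain ⟨i, hi⟩ := Finset.card_eq_one.1 hc
    refine ⟨i, ?_⟩
    have h1 : d i = k := by simpa [parts, hi] using h
    rw [← h1]
    exact Finsupp.support_subset_singleton.1 hi.subset
  · rintro ⟨i, rfl⟩
    simp [parts, Finsupp.support_single, hk]

lemma coeff_pSym {k : ℕ} (hk : k ≠ 0) (d : ℕ →₀ ℕ) [Decidable (∃ i, d = Finsupp.single i k)] :
    MvPowerSeries.coeff d (pSym k : MvPowerSeries ℕ ℚ) =
      if ∃ i, d = Finsupp.single i k then 1 else 0 := by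
  rw [pSym, coeff_mSym]
  simp only [parts_eq_singleton_iff hk]

/-- A monomial of `p_k` is some `x_i ^ k`, and it divides `x ^ d` exactly when `k ≤ d i`, so the
antidiagonal sum collapses to a sum over such `i`. -/
lemma coeff_pSym_mul {k : ℕ} (hk : k ≠ 0) (f : MvPowerSeries ℕ ℚ) (d : ℕ →₀ ℕ) :
    MvPowerSeries.coeff d ((pSym k : MvPowerSeries ℕ ℚ) * f) =
      ∑ i ∈ d.support with k ≤ d i, MvPowerSeries.coeff (d - Finsupp.single i k) f := by
  classical
  rw [MvPowerSeries.coeff_mul]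
  symm
  refine Finset.sum_of_injOn (fun i => (Finsupp.single i k, d - Finsupp.single i k)) ?_ ?_ ?_ ?_
  · intro i _ j _ h
    exact Finsupp.single_left_injective hk (Prod.ext_iff.1 h).1
  · intro i hi
    simp only [Finset.coe_filter, Set.mem_ofPred_eq] at hi
    rw [Finset.mem_coe, Finset.HasAntidiagonal.mem_antidiagonal]
    exact add_tsub_cancel_of_le (Finsupp.single_le_iff.2 hi.2)
  · intro x hx hx'
    rw [coeff_pSym hk, if_neg, zero_mul]
    rintro ⟨i, hi⟩
    rw [Finset.HasAntidiagonal.mem_antidiagonal, hi] at hx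
    have hki : k ≤ d i := by
      rw [← hx]
      simp
    refine hx' ⟨i, ?_, ?_⟩
    · simp only [Finset.coe_filter, Set.mem_ofPred_eq, Finsupp.mem_support_iff]
      exact ⟨by omega, hki⟩
    · refine Prod.ext hi.symm ?_
      change d - Finsupp.single i k = x.2
      rw [← hx, add_tsub_cancel_left]
  · intro i _
    rw [coeff_pSym hk, if_pos ⟨i, rfl⟩, one_mul]

/-- An arbitrary embedding is allowed so that `inZ`, `inY` and `inZY` are all covered. -/
lemma coeff_rename_pSym {τ : Type*} (e : ℕ ↪ τ) {k : ℕ} (hk : k ≠ 0) (x : τ →₀ ℕ)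
    [Decidable (∃ i, x = Finsupp.single (e i) k)] :
    MvPowerSeries.coeff x (MvPowerSeries.rename e (pSym k : MvPowerSeries ℕ ℚ)) =
      if ∃ i, x = Finsupp.single (e i) k then 1 else 0 := by
  classical
  by_cases hx : x ∈ Set.range (Finsupp.mapDomain (M := ℕ) e)
  · obtain ⟨y, rfl⟩ := hx
    have h : (∃ i, y.mapDomain e = Finsupp.single (e i) k) ↔ ∃ i, y = Finsupp.single i k := by
      refine exists_congr fun i => ?_
      rw [← Finsupp.mapDomain_single]
      exact (Finsupp.mapDomain_injective e.injective).eq_iff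
    simp only [h]
    rw [← coeff_pSym hk, ← Finsupp.embDomain_eq_mapDomain, MvPowerSeries.coeff_embDomain_rename]
  · rw [MvPowerSeries.coeff_rename_eq_zero _ _ hx, if_neg]
    rintro ⟨i, rfl⟩
    exact hx ⟨Finsupp.single i k, Finsupp.mapDomain_single⟩

lemma inZY_pSym {k : ℕ} (hk : k ≠ 0) : inZY (pSym k) = inZ (pSym k) + inY (pSym k) := by
  classical
  ext x
  rw [map_add]
  have h1 := coeff_rename_pSym Equiv.natSumNatEquivNat.symm.toEmbedding hk x
  have h2 := coeff_rename_pSym (Function.Embedding.inl : ℕ ↪ ℕ ⊕ ℕ) hk x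
  have h3 := coeff_rename_pSym (Function.Embedding.inr : ℕ ↪ ℕ ⊕ ℕ) hk x
  change MvPowerSeries.coeff x (MvPowerSeries.rename Equiv.natSumNatEquivNat.symm.toEmbedding _) =
    MvPowerSeries.coeff x (MvPowerSeries.rename _ _) +
      MvPowerSeries.coeff x (MvPowerSeries.rename _ _)
  refine h1.trans ((congrArg₂ (· + ·) h2 h3).trans ?_).symm
  have h : (∃ i, x = Finsupp.single (Equiv.natSumNatEquivNat.symm.toEmbedding i) k) ↔
      (∃ i, x = Finsupp.single (Sum.inl i) k) ∨ ∃ i, x = Finsupp.single (Sum.inr i) k := by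
    rw [← Sum.exists (p := fun j => x = Finsupp.single j k)]
    exact Equiv.natSumNatEquivNat.symm.surjective.exists (p := fun j => x = Finsupp.single j k).symm
  simp only [h]
  -- The two alternatives exclude each other because `k ≠ 0`, so the indicator of the disjunction is
  -- the sum of the indicators.
  by_cases hl : ∃ i : ℕ, x = Finsupp.single (Sum.inl i) k
  · have hr : ¬ ∃ i : ℕ, x = Finsupp.single (Sum.inr i) k := by
      rintro ⟨j, hj⟩
      obtain ⟨i, hi⟩ := hl
      exact Sum.inl_ne_inr (Finsupp.single_left_injective hk (hi.symm.trans hj))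
    simp [hl, hr]
  · by_cases hr : ∃ i : ℕ, x = Finsupp.single (Sum.inr i) k <;> simp [hl, hr]

lemma negVars_pSym {k : ℕ} (hk : k ≠ 0) : negVars (pSym k) = (-1 : ℚ) ^ k • pSym k := by
  classical
  apply Subtype.ext
  ext d
  change MvPowerSeries.coeff d (MvPowerSeries.rescaleAlgHom (fun _ : ℕ => (-1 : ℚ)) (pSym k).1) =
    MvPowerSeries.coeff d ((-1 : ℚ) ^ k • (pSym k : MvPowerSeries ℕ ℚ))
  rw [MvPowerSeries.rescaleAlgHom_apply, MvPowerSeries.coeff_rescale, map_smul, smul_eq_mul,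
    coeff_pSym hk]
  split_ifs with h
  · obtain ⟨i, rfl⟩ := h
    rw [Finsupp.prod_single_index (h := fun _ m => (-1 : ℚ) ^ m) (pow_zero _)]
  · simp

/-! ### Newton's identities and `ω` on power sums -/

lemma cut_pSym {k : ℕ} (hk : k ≠ 0) (N : ℕ) :
    cut N (pSym k) =
      ((MvPolynomial.psum (Fin N) ℚ k : MvPolynomial (Fin N) ℚ) : MvPowerSeries (Fin N) ℚ) := by
  classical
  ext x
  rw [coeff_cut, MvPolynomial.coeff_coe, MvPolynomial.psum, MvPolynomial.coeff_sum, coeff_pSym hk]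
  simp only [MvPolynomial.coeff_X_pow]
  have he : ∀ i : Fin N, (Finsupp.single i k).embDomain Fin.valEmbedding =
      Finsupp.single (i : ℕ) k := fun i => Finsupp.embDomain_single _ _ _
  by_cases h : ∃ i, x = Finsupp.single i k
  · obtain ⟨i, rfl⟩ := h
    rw [if_pos ⟨i, he i⟩, Finset.sum_eq_single i]
    · simp
    · intro j _ hj
      exact if_neg fun h => hj (Finsupp.single_left_injective hk h)
    · simp
  · rw [if_neg, Finset.sum_eq_zero fun i _ => if_neg fun hi => h ⟨i, hi.symm⟩]
    rintro ⟨i, hi⟩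
    have hi' : i ∈ (x.embDomain Fin.valEmbedding).support := by
      rw [hi]
      simp [hk]
    rw [Finsupp.support_embDomain, Finset.mem_map] at hi'
    obtain ⟨j, _, rfl⟩ := hi'
    exact h ⟨j, Finsupp.embDomain_injective _ (hi.trans (he j).symm)⟩

lemma eq_of_forall_cut {f g : SymFun} (h : ∀ N, cut N f = cut N g) : f = g := by
  apply Subtype.ext
  ext d
  -- A monomial of degree `d.degree` involves at most that many variables, so this cut already sees
  -- its coefficient.
  have := eq_zero_of_cut (N := d.degree) (f := f - g) (by rw [map_sub, h, sub_self]) d le_rfl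
  rw [← sub_eq_zero, ← map_sub]
  exact this

/-- Newton's identity holds in every finite number of variables, and the cuts jointly separate
symmetric functions. -/
lemma mul_eSym_eq_sum (k : ℕ) :
    (k : SymFun) * eSym k = (-1) ^ (k + 1) *
      ∑ a ∈ Finset.HasAntidiagonal.antidiagonal k with a.1 < k, (-1) ^ a.1 * eSym a.1 * pSym a.2 := by
  refine eq_of_forall_cut fun N => ?_
  have h := congrArg (MvPolynomial.coeToMvPowerSeries.ringHom (R := ℚ))
    (MvPolynomial.mul_esymm_eq_sum (Fin N) ℚ k)
  simp only [map_mul, map_natCast, map_pow, map_neg, map_one, map_sum,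
    MvPolynomial.coeToMvPowerSeries.ringHom_apply] at h
  simp only [map_mul, map_natCast, map_pow, map_neg, map_one, map_sum, cut_eSym, h]
  refine congrArg _ (Finset.sum_congr rfl fun a ha => ?_)
  rw [Finset.mem_filter, Finset.HasAntidiagonal.mem_antidiagonal] at ha
  rw [cut_pSym (by omega)]

/-- For a monomial `x ^ d` of degree `k`, the right-hand coefficient counts the pairs `(j, i)` with
`1 ≤ i + 1 ≤ d j`. There are `∑ d j = k` of them. -/
lemma mul_hSym_eq_sum (k : ℕ) :
    (k : SymFun) * hSym k =
      ∑ a ∈ Finset.HasAntidiagonal.antidiagonal k with a.1 < k, hSym a.1 * pSym a.2 := by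
  classical
  have h1 : ∑ a ∈ Finset.HasAntidiagonal.antidiagonal k with a.1 < k, hSym a.1 * pSym a.2 =
      ∑ i ∈ Finset.range k, pSym (i + 1) * hSym (k - (i + 1)) := by
    refine Finset.sum_nbij' (fun a => a.2 - 1) (fun i => (k - (i + 1), i + 1)) ?_ ?_ ?_ ?_ ?_
    · intro a ha
      simp only [Finset.mem_filter, Finset.HasAntidiagonal.mem_antidiagonal, Finset.mem_range] at ha ⊢
      omega
    · intro i hi
      simp only [Finset.mem_filter, Finset.HasAntidiagonal.mem_antidiagonal, Finset.mem_range] at hi ⊢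
      omega
    · intro a ha
      simp only [Finset.mem_filter, Finset.HasAntidiagonal.mem_antidiagonal] at ha
      ext <;> dsimp only <;> omega
    · intro i _
      simp
    · intro a ha
      simp only [Finset.mem_filter, Finset.HasAntidiagonal.mem_antidiagonal] at ha
      rw [show a.2 - 1 + 1 = a.2 by omega, show k - a.2 = a.1 by omega, mul_comm]
  rw [h1, ← nsmul_eq_mul]
  apply Subtype.ext
  ext d
  rw [AddSubmonoidClass.coe_finsetSum, map_sum]
  have h2 : ∀ i ∈ Finset.range k, MvPowerSeries.coeff d
      ((pSym (i + 1) * hSym (k - (i + 1)) : SymFun) : MvPowerSeries ℕ ℚ) =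
      ∑ j ∈ d.support, if i + 1 ≤ d j ∧ d.degree = k then 1 else 0 := by
    intro i hi
    rw [Finset.mem_range] at hi
    refine (coeff_pSym_mul (Nat.succ_ne_zero i) _ d).trans ?_
    rw [Finset.sum_filter]
    refine Finset.sum_congr rfl fun j _ => ?_
    rw [coeff_hSym]
    by_cases hj : i + 1 ≤ d j
    · have hd : (d - Finsupp.single j (i + 1)).degree + (i + 1) = d.degree := by
        conv_rhs => rw [← tsub_add_cancel_of_le (Finsupp.single_le_iff.2 hj), map_add,
          Finsupp.degree_single]
      have : (d - Finsupp.single j (i + 1)).degree = k - (i + 1) ↔ d.degree = k := by omega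
      rw [if_pos hj]
      simp only [this, hj, true_and]
    · simp [hj]
  rw [Finset.sum_congr rfl h2, Finset.sum_comm]
  change MvPowerSeries.coeff d (k • (hSym k : MvPowerSeries ℕ ℚ)) = _
  rw [map_nsmul, coeff_hSym]
  by_cases hd : d.degree = k
  · simp only [hd, and_true, if_true]
    have h3 : ∀ j ∈ d.support, ∑ i ∈ Finset.range k, (if i + 1 ≤ d j then (1 : ℚ) else 0) = d j := by
      intro j hj
      have hjk : d j ≤ k := hd ▸ Finsupp.le_degree j d
      rw [Finset.sum_boole]
      have : Finset.filter (fun i => i + 1 ≤ d j) (Finset.range k) = Finset.range (d j) := by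
        ext i
        simp only [Finset.mem_filter, Finset.mem_range]
        omega
      rw [this, Finset.card_range]
    have h4 : d.degree = ∑ j ∈ d.support, d j := rfl
    rw [Finset.sum_congr rfl h3, nsmul_eq_mul, mul_one, ← hd, h4, Nat.cast_sum]
  · simp [hd]

lemma eSym_zero : eSym 0 = 1 := by
  refine eq_of_forall_cut fun N => ?_
  rw [cut_eSym, MvPolynomial.esymm_zero, map_one, MvPolynomial.coe_one]

lemma hSym_zero : hSym 0 = 1 := by
  classical
  apply Subtype.ext
  ext d
  change _ = MvPowerSeries.coeff d (1 : MvPowerSeries ℕ ℚ)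
  rw [coeff_hSym, MvPowerSeries.coeff_one]
  simp only [Finsupp.degree_eq_zero_iff]

lemma omega_eSym' (k : ℕ) : omega (eSym k) = hSym k := by
  rcases Nat.eq_zero_or_pos k with rfl | hk
  · rw [eSym_zero, hSym_zero, map_one]
  · exact omega_eSym k hk

/-- Applying `ω` to Newton's identity for `e_k` must reproduce the one for `h_k`. By induction all
terms agree except the one with index `(0, k)`, so these agree as well. -/
lemma omega_pSym {k : ℕ} (hk : k ≠ 0) : omega (pSym k) = (-1) ^ (k + 1) * pSym k := by
  induction k using Nat.strong_induction_on with
  | _ k ih =>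
    have h := congrArg omega (mul_eSym_eq_sum k)
    simp only [map_mul, map_natCast, map_pow, map_neg, map_one, map_sum, omega_eSym',
      mul_hSym_eq_sum] at h
    have hm : ((0, k) : ℕ × ℕ) ∈ (Finset.HasAntidiagonal.antidiagonal k).filter fun a => a.1 < k := by
      simp only [Finset.mem_filter, Finset.HasAntidiagonal.mem_antidiagonal]
      omega
    have hs : ∀ a ∈ ((Finset.HasAntidiagonal.antidiagonal k).filter fun a => a.1 < k).erase (0, k),
        (-1) ^ (k + 1) * ((-1) ^ a.1 * hSym a.1 * omega (pSym a.2)) = hSym a.1 * pSym a.2 := by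
      intro a ha
      simp only [Finset.mem_erase, Finset.mem_filter, Finset.HasAntidiagonal.mem_antidiagonal,
        ne_eq] at ha
      obtain ⟨h0, rfl, h2⟩ := ha
      have h3 : a.1 ≠ 0 := fun h => h0 (by ext <;> simp [h])
      rw [ih a.2 (by omega) (by omega)]
      have : ((-1 : SymFun)) ^ (a.1 + a.2 + 1) * (-1) ^ a.1 * (-1) ^ (a.2 + 1) = 1 := by
        rw [← pow_add, ← pow_add]
        have he : Even (a.1 + a.2 + 1 + a.1 + (a.2 + 1)) := ⟨a.1 + a.2 + 1, by ring⟩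
        exact he.neg_one_pow (α := SymFun)
      linear_combination hSym a.1 * pSym a.2 * this
    rw [Finset.mul_sum, ← Finset.add_sum_erase _ _ hm, ← Finset.add_sum_erase _ _ hm,
      Finset.sum_congr rfl hs] at h
    have h' := add_right_cancel h
    rw [hSym_zero, pow_zero, one_mul, one_mul, one_mul] at h'
    change pSym k = (-1) ^ (k + 1) * omega (pSym k) at h'
    conv_rhs => rw [h']
    rw [← mul_assoc, ← mul_pow, show (-1 : SymFun) * -1 = 1 by ring, one_pow, one_mul]

/-! ### The product of a power sum and an augmented monomial symmetric function -/

/-- The product `r₁! r₂! ⋯` of the factorials of the multiplicities of a multiset. -/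
def multFactorial (μ : Multiset ℕ) : ℕ := ∏ i ∈ μ.toFinset, (μ.count i).factorial

lemma multFactorial_cons (a : ℕ) (μ : Multiset ℕ) :
    multFactorial (a ::ₘ μ) = (μ.count a + 1) * multFactorial μ := by
  -- Since `0! = 1`, the product may run over any larger index set; both sides are put over the same
  -- one.
  have h : ∀ ν : Multiset ℕ, ∀ s : Finset ℕ, ν.toFinset ⊆ s →
      multFactorial ν = ∏ i ∈ s, (ν.count i).factorial := by
    intro ν s hs
    refine Finset.prod_subset hs fun i _ hi => ?_
    rw [Multiset.mem_toFinset] at hi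
    rw [Multiset.count_eq_zero_of_notMem hi, Nat.factorial_zero]
  have ha : a ∈ insert a μ.toFinset := Finset.mem_insert_self _ _
  rw [h (a ::ₘ μ) (insert a μ.toFinset) (by rw [Multiset.toFinset_cons]),
    h μ (insert a μ.toFinset) (Finset.subset_insert _ _), ← Finset.mul_prod_erase _ _ ha,
    ← Finset.mul_prod_erase _ _ ha, Multiset.count_cons_self, Nat.factorial_succ, ← mul_assoc]
  congr 1
  refine Finset.prod_congr rfl fun i hi => ?_
  rw [Multiset.count_cons_of_ne (Finset.ne_of_mem_erase hi)]

lemma coeff_augmentedMSym (μ : Multiset ℕ) (d : ℕ →₀ ℕ) :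
    MvPowerSeries.coeff d (augmentedMSym μ : MvPowerSeries ℕ ℚ) =
      if parts d = μ then (multFactorial μ : ℚ) else 0 := by
  change MvPowerSeries.coeff d ((multFactorial μ : ℚ) • (mSym μ : MvPowerSeries ℕ ℚ)) = _
  rw [map_smul, coeff_mSym, smul_eq_mul, mul_ite, mul_one, mul_zero]

lemma parts_sub_single (d : ℕ →₀ ℕ) {i k : ℕ} (hi : i ∈ d.support) (hk : k ≤ d i) :
    parts (d - Finsupp.single i k) =
      if d i = k then (parts d).erase k else (d i - k) ::ₘ (parts d).erase (d i) := by
  classical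
  have herase : ∀ e : ℕ →₀ ℕ, i ∈ e.support →
      parts e = e i ::ₘ (e.support.erase i).val.map e := by
    intro e he
    rw [parts, ← Multiset.map_cons, ← Finset.insert_val_of_notMem (Finset.notMem_erase _ _),
      Finset.insert_erase he]
  have hoff : ∀ j, j ≠ i → (d - Finsupp.single i k) j = d j := by
    intro j hj
    rw [Finsupp.tsub_apply, Finsupp.single_eq_of_ne hj, tsub_zero]
  have hat : (d - Finsupp.single i k) i = d i - k := by
    rw [Finsupp.tsub_apply, Finsupp.single_eq_same]
  have hsupp : (d - Finsupp.single i k).support.erase i = d.support.erase i := by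
    ext j
    simp only [Finset.mem_erase, Finsupp.mem_support_iff]
    refine and_congr_right fun hj => ?_
    rw [hoff j hj]
  have hmap : ((d - Finsupp.single i k).support.erase i).val.map (d - Finsupp.single i k) =
      (d.support.erase i).val.map d := by
    rw [hsupp]
    exact Multiset.map_congr rfl fun j hj => hoff j (Finset.ne_of_mem_erase hj)
  have hd : (parts d).erase (d i) = (d.support.erase i).val.map d := by
    rw [herase d hi, Multiset.erase_cons_head]
  split_ifs with h
  · rw [← h, hd, ← hmap, Finset.erase_eq_of_notMem, h]
    · rfl
    · rw [Finsupp.notMem_support_iff, hat, h, tsub_self]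
  · rw [herase, hat, hmap, hd]
    rw [Finsupp.mem_support_iff, hat]
    omega

/-- This is the coefficient comparison behind `pSym_mul_augmentedMSym`, at a monomial with exponents
`ρ`. Removing `k` from a part `x` either deletes it or shrinks it. In the second case, with `ν` the
remaining parts, both sides equal `(count x ν + 1) (count (x - k) ν + 1)` times the factorials of
`ν`. -/
lemma sum_count_mul_multFactorial (k : ℕ) (μ ρ : Multiset ℕ) (hμ : 0 ∉ μ) :
    (ρ.map fun x => if x = k then (if ρ.erase k = μ then (multFactorial μ : ℚ) else 0) else
        if k < x ∧ (x - k) ::ₘ ρ.erase x = μ then (multFactorial μ : ℚ) else 0).sum =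
      (if ρ = k ::ₘ μ then (multFactorial (k ::ₘ μ) : ℚ) else 0) +
      (μ.map fun j => if ρ = (j + k) ::ₘ μ.erase j then
        (multFactorial ((j + k) ::ₘ μ.erase j) : ℚ) else 0).sum := by
  have hsplit : ∀ x, (if x = k then (if ρ.erase k = μ then (multFactorial μ : ℚ) else 0) else
        if k < x ∧ (x - k) ::ₘ ρ.erase x = μ then (multFactorial μ : ℚ) else 0) =
      (if x = k then (if ρ.erase k = μ then (multFactorial μ : ℚ) else 0) else 0) +
      (if k < x ∧ (x - k) ::ₘ ρ.erase x = μ then (multFactorial μ : ℚ) else 0) := by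
    intro x
    by_cases hx : x = k
    · simp [hx]
    · simp [hx]
  simp only [hsplit, Multiset.sum_map_add]
  congr 1
  · rw [Finset.sum_multiset_map_count]
    simp only [smul_ite, smul_zero]
    rw [Finset.sum_ite_eq']
    by_cases h : ρ = k ::ₘ μ
    · subst h
      simp [multFactorial_cons]
    · rw [if_neg h]
      split_ifs with h1 h2
      · refine absurd ?_ h
        rw [← h2, Multiset.cons_erase (Multiset.mem_toFinset.1 h1)]
      · rfl
      · rfl
  · rw [Finset.sum_multiset_map_count, Finset.sum_multiset_map_count]
    simp only [smul_ite, smul_zero]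
    rw [← Finset.sum_filter, ← Finset.sum_filter]
    refine Finset.sum_bij' (fun x _ => x - k) (fun j _ => j + k) ?_ ?_ ?_ ?_ ?_
    · intro x hx
      simp only [Finset.mem_filter, Multiset.mem_toFinset] at hx ⊢
      obtain ⟨h1, h2, h3⟩ := hx
      refine ⟨?_, ?_⟩
      · rw [← h3]
        exact Multiset.mem_cons_self _ _
      · rw [← h3, Multiset.erase_cons_head, Nat.sub_add_cancel h2.le, Multiset.cons_erase h1]
    · intro j hj
      simp only [Finset.mem_filter, Multiset.mem_toFinset] at hj ⊢
      obtain ⟨h1, h2⟩ := hj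
      -- A part `j = 0` would give `x = k`, which belongs to the other case.
      have h0 : j ≠ 0 := fun h => hμ (h ▸ h1)
      refine ⟨?_, by omega, ?_⟩
      · rw [h2]
        exact Multiset.mem_cons_self _ _
      · rw [h2, Multiset.erase_cons_head, Nat.add_sub_cancel, Multiset.cons_erase h1]
    · intro x hx
      simp only [Finset.mem_filter] at hx
      exact Nat.sub_add_cancel hx.2.1.le
    · intro j _
      exact Nat.add_sub_cancel j k
    · intro x hx
      simp only [Finset.mem_filter, Multiset.mem_toFinset] at hx
      obtain ⟨h1, h2, h3⟩ := hx
      obtain ⟨ν, rfl⟩ := Multiset.exists_cons_of_mem h1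
      rw [Multiset.erase_cons_head] at h3
      subst h3
      rw [Multiset.erase_cons_head, Nat.sub_add_cancel h2.le, multFactorial_cons,
        multFactorial_cons, Multiset.count_cons_self, Multiset.count_cons_self]
      simp only [nsmul_eq_mul]
      push_cast
      ring

/-- The augmented function sums `x_{i₁}^{μ₁} x_{i₂}^{μ₂} ⋯` over tuples of distinct indices. In the
product with `x_i ^ k`, the index `i` is either new, adjoining a part `k`, or one of the `i_j`,
adding `k` to that part. -/
lemma pSym_mul_augmentedMSym {k : ℕ} (hk : k ≠ 0) {μ : Multiset ℕ} (hμ : 0 ∉ μ) :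
    pSym k * augmentedMSym μ = augmentedMSym (k ::ₘ μ) +
      (μ.map fun j => augmentedMSym ((j + k) ::ₘ μ.erase j)).sum := by
  classical
  apply Subtype.ext
  ext d
  refine (coeff_pSym_mul hk _ d).trans ?_
  have hr : MvPowerSeries.coeff d ((augmentedMSym (k ::ₘ μ) +
      (μ.map fun j => augmentedMSym ((j + k) ::ₘ μ.erase j)).sum : SymFun) : MvPowerSeries ℕ ℚ) =
      MvPowerSeries.coeff d (augmentedMSym (k ::ₘ μ) : MvPowerSeries ℕ ℚ) +
      (μ.map fun j => MvPowerSeries.coeff d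
        (augmentedMSym ((j + k) ::ₘ μ.erase j) : MvPowerSeries ℕ ℚ)).sum := by
    let φ : SymFun →ₗ[ℚ] ℚ := (MvPowerSeries.coeff d).comp SymFun.val.toLinearMap
    have := map_multiset_sum φ (μ.map fun j => augmentedMSym ((j + k) ::ₘ μ.erase j))
    rw [Multiset.map_map] at this
    exact (map_add φ _ _).trans (congrArg _ this)
  rw [hr]
  simp only [coeff_augmentedMSym]
  rw [← sum_count_mul_multFactorial k μ (parts d) hμ, Finset.sum_filter]
  conv_rhs => rw [parts, Multiset.map_map]
  refine Finset.sum_congr rfl fun i hi => ?_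
  by_cases hki : k ≤ d i
  · rw [if_pos hki, parts_sub_single d hi hki]
    rcases eq_or_lt_of_le hki with h | h
    · simp [← h, parts]
    · simp [h, h.ne', parts]
  · have h1 : d i ≠ k := by omega
    have h2 : ¬ k < d i := by omega
    simp [hki, h1, h2]

/-! ### Sums over ordered set partitions -/

section Powerset

variable {α M : Type*} [DecidableEq α] [AddCommMonoid M]

lemma sum_powerset_sdiff_comm (f : Finset α → Finset α → M) (X : Finset α) :
    ∑ Y ∈ X.powerset, f Y (X \ Y) = ∑ Y ∈ X.powerset, f (X \ Y) Y := by
  refine Finset.sum_nbij' (fun Y => X \ Y) (fun Y => X \ Y) ?_ ?_ ?_ ?_ ?_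
  · intro Y _
    exact Finset.mem_powerset.2 Finset.sdiff_subset
  · intro Y _
    exact Finset.mem_powerset.2 Finset.sdiff_subset
  · intro Y hY
    exact Finset.sdiff_sdiff_eq_self (Finset.mem_powerset.1 hY)
  · intro Y hY
    exact Finset.sdiff_sdiff_eq_self (Finset.mem_powerset.1 hY)
  · intro Y hY
    rw [Finset.sdiff_sdiff_eq_self (Finset.mem_powerset.1 hY)]

/-- Both sides run over the ordered splittings of `X` into three disjoint, possibly empty sets. -/
lemma sum_powerset_powerset (f : Finset α → Finset α → Finset α → M) (X : Finset α) :
    ∑ Y ∈ X.powerset, ∑ Z ∈ Y.powerset, f Z (Y \ Z) (X \ Y) =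
      ∑ Z ∈ X.powerset, ∑ W ∈ (X \ Z).powerset, f Z W ((X \ Z) \ W) := by
  rw [Finset.sum_sigma', Finset.sum_sigma']
  refine Finset.sum_bij' (fun x _ => ⟨x.2, x.1 \ x.2⟩) (fun x _ => ⟨x.1 ∪ x.2, x.1⟩) ?_ ?_ ?_ ?_ ?_
  · rintro ⟨Y, Z⟩ h
    simp only [Finset.mem_sigma, Finset.mem_powerset] at h ⊢
    exact ⟨h.2.trans h.1, Finset.sdiff_subset_sdiff h.1 subset_rfl⟩
  · rintro ⟨Z, W⟩ h
    simp only [Finset.mem_sigma, Finset.mem_powerset] at h ⊢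
    exact ⟨Finset.union_subset h.1 (h.2.trans Finset.sdiff_subset), Finset.subset_union_left⟩
  · rintro ⟨Y, Z⟩ h
    simp only [Finset.mem_sigma, Finset.mem_powerset] at h
    simp only [Finset.union_sdiff_of_subset h.2]
  · rintro ⟨Z, W⟩ h
    simp only [Finset.mem_sigma, Finset.mem_powerset] at h
    have : Disjoint Z W := Finset.disjoint_of_subset_right h.2 Finset.disjoint_sdiff
    simp only [Finset.union_sdiff_cancel_left this]
  · rintro ⟨Y, Z⟩ h
    simp only [Finset.mem_sigma, Finset.mem_powerset] at h
    rw [sdiff_sdiff, Finset.sup_eq_union, Finset.union_sdiff_of_subset h.2]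

end Powerset

/-! ### Cutting a list in two -/

section CutSum

variable {α R : Type*} [CommRing R]

/-- The sum of `F q e` over all decompositions `w = q ++ e`. -/
def cutSum (F : List α → List α → R) (w : List α) : R :=
  ∑ i ∈ Finset.range (w.length + 1), F (w.take i) (w.drop i)

lemma cutSum_nil (F : List α → List α → R) : cutSum F [] = F [] [] := by
  simp [cutSum]

lemma cutSum_cons (F : List α → List α → R) (x : α) (w : List α) :
    cutSum F (x :: w) = F [] (x :: w) + cutSum (fun q e => F (x :: q) e) w := by
  rw [cutSum, List.length_cons, Finset.sum_range_succ', add_comm]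
  rfl

end CutSum

/-! ### Orderings of a finite set -/

section Orderings

variable {α R : Type*} [DecidableEq α]

/-- The orderings of a finite set, as lists without repetition. -/
def orderings (X : Finset α) : Finset (List α) := ⟨X.val.lists, Multiset.lists_nodup_finset X⟩

lemma mem_orderings {X : Finset α} {w : List α} :
    w ∈ orderings X ↔ w.Nodup ∧ w.toFinset = X := by
  rw [orderings, Finset.mem_mk, Multiset.mem_lists_iff]
  constructor
  · intro h
    have hn : w.Nodup := by
      have := X.nodup
      rw [h] at this
      exact this
    refine ⟨hn, Finset.val_injective ?_⟩
    rw [List.toFinset_val, hn.dedup, h]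
    rfl
  · rintro ⟨hn, rfl⟩
    rw [List.toFinset_val, hn.dedup]
    rfl

lemma orderings_empty : orderings (∅ : Finset α) = {[]} := by
  ext w
  rw [mem_orderings, Finset.mem_singleton, List.toFinset_eq_empty_iff]
  constructor
  · exact fun h => h.2
  · rintro rfl
    exact ⟨List.nodup_nil, rfl⟩

variable [CommRing R]

lemma sum_orderings_cutSum (F : List α → List α → R) (X : Finset α) :
    ∑ w ∈ orderings X, cutSum F w =
      ∑ Y ∈ X.powerset, ∑ q ∈ orderings Y, ∑ e ∈ orderings (X \ Y), F q e := by
  simp only [cutSum, ← Finset.sum_product', Finset.sum_sigma']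
  refine Finset.sum_bij' (fun x _ => ⟨(x.1.take x.2).toFinset, (x.1.take x.2, x.1.drop x.2)⟩)
    (fun x _ => ⟨x.2.1 ++ x.2.2, x.2.1.length⟩) ?_ ?_ ?_ ?_ ?_
  · rintro ⟨w, i⟩ h
    simp only [Finset.mem_sigma, mem_orderings, Finset.mem_range] at h
    obtain ⟨⟨hn, rfl⟩, hi⟩ := h
    have hd := hn
    rw [← List.take_append_drop i w, List.nodup_append'] at hd
    simp only [Finset.mem_sigma, Finset.mem_powerset, Finset.mem_product, mem_orderings]
    refine ⟨?_, ⟨hd.1, trivial⟩, hd.2.1, ?_⟩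
    · intro x hx
      rw [List.mem_toFinset] at hx ⊢
      exact List.mem_of_mem_take hx
    · conv_rhs => rw [← List.take_append_drop i w, List.toFinset_append]
      simp only [List.take_append_drop]
      rw [Finset.union_sdiff_cancel_left]
      exact List.disjoint_toFinset_iff_disjoint.2 hd.2.2
  · rintro ⟨Y, q, e⟩ h
    simp only [Finset.mem_sigma, Finset.mem_powerset, Finset.mem_product, mem_orderings] at h
    obtain ⟨hY, ⟨hq, rfl⟩, he, heq⟩ := h
    simp only [Finset.mem_sigma, mem_orderings, Finset.mem_range, List.length_append]
    refine ⟨⟨?_, ?_⟩, by omega⟩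
    · rw [List.nodup_append']
      refine ⟨hq, he, ?_⟩
      rw [← List.disjoint_toFinset_iff_disjoint, heq]
      exact Finset.disjoint_sdiff
    · rw [List.toFinset_append, heq, Finset.union_sdiff_of_subset hY]
  · rintro ⟨w, i⟩ h
    simp only [Finset.mem_sigma, Finset.mem_range] at h
    simp only [List.take_append_drop, List.length_take]
    rw [min_eq_left (by omega)]
  · rintro ⟨Y, q, e⟩ h
    simp only [Finset.mem_sigma, Finset.mem_product, mem_orderings] at h
    obtain ⟨-, ⟨-, rfl⟩, -⟩ := h
    simp
  · rintro ⟨w, i⟩ _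
    rfl

/-- The element `v` occurs exactly once in an ordering and splits it into orderings of two
complementary subsets of `X`. -/
lemma sum_orderings_insert (F : List α → R) {v : α} {X : Finset α} (hv : v ∉ X) :
    ∑ w ∈ orderings (insert v X), F w =
      ∑ Y ∈ X.powerset, ∑ p ∈ orderings Y, ∑ s ∈ orderings (X \ Y), F (p ++ v :: s) := by
  simp only [← Finset.sum_product', Finset.sum_sigma']
  symm
  have key : ∀ p s : List α, p ++ v :: s ∈ orderings (insert v X) ↔
      v ∉ p ∧ v ∉ s ∧ p.toFinset ⊆ X ∧ p.Nodup ∧ s ∈ orderings (X \ p.toFinset) := by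
    intro p s
    simp only [mem_orderings]
    rw [List.perm_middle.nodup_iff, List.nodup_cons, List.nodup_append', List.mem_append, not_or,
      ← List.disjoint_toFinset_iff_disjoint, List.toFinset_append, List.toFinset_cons,
      Finset.union_insert]
    constructor
    · rintro ⟨⟨⟨h1, h2⟩, h3, h4, h5⟩, h6⟩
      have h7 : p.toFinset ∪ s.toFinset = X := by
        rw [← Finset.erase_insert hv, ← h6, Finset.erase_insert]
        simp [h1, h2]
      refine ⟨h1, h2, ?_, h3, h4, ?_⟩
      · rw [← h7]
        exact Finset.subset_union_left
      · rw [← h7, Finset.union_sdiff_cancel_left h5]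
    · rintro ⟨h1, h2, h3, h4, h5, h6⟩
      refine ⟨⟨⟨h1, h2⟩, h4, h5, ?_⟩, ?_⟩
      · rw [h6]
        exact Finset.disjoint_sdiff
      · rw [h6, Finset.union_sdiff_of_subset h3]
  have key' : ∀ x ∈ X.powerset.sigma fun Y => orderings Y ×ˢ orderings (X \ Y),
      x.2.1.toFinset = x.1 ∧ v ∉ x.2.1 ∧ v ∉ x.2.2 ∧
        x.2.1 ++ v :: x.2.2 ∈ orderings (insert v X) := by
    rintro ⟨Y, p, s⟩ h
    simp only [Finset.mem_sigma, Finset.mem_product, Finset.mem_powerset] at h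
    obtain ⟨hY, hp, hs⟩ := h
    obtain ⟨hpn, rfl⟩ := mem_orderings.1 hp
    have h1 : v ∉ p := fun h => hv (hY (List.mem_toFinset.2 h))
    have h2 : v ∉ s := by
      intro h
      rw [← List.mem_toFinset, (mem_orderings.1 hs).2] at h
      exact hv (Finset.mem_sdiff.1 h).1
    exact ⟨rfl, h1, h2, (key p s).2 ⟨h1, h2, hY, hpn, hs⟩⟩
  refine Finset.sum_bij (fun x _ => x.2.1 ++ v :: x.2.2) ?_ ?_ ?_ ?_
  · exact fun x hx => (key' x hx).2.2.2
  · rintro ⟨Y, p, s⟩ hx ⟨Y', p', s'⟩ hx' h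
    obtain ⟨hY, -⟩ := key' _ hx
    obtain ⟨hY', -⟩ := key' _ hx'
    dsimp only at hY hY' h
    subst hY hY'
    have hvs : v ∉ s := (key' _ hx).2.2.1
    obtain ⟨rfl, -, rfl⟩ := (List.append_cons_inj_of_notMem (key' _ hx).2.1 hvs).1 h
    rfl
  · intro w hw
    have hvw : v ∈ w := by
      rw [← List.mem_toFinset, (mem_orderings.1 hw).2]
      exact Finset.mem_insert_self _ _
    obtain ⟨p, s, rfl⟩ := List.append_of_mem hvw
    obtain ⟨-, -, h1, h2, h3⟩ := (key p s).1 hw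
    refine ⟨⟨p.toFinset, p, s⟩, ?_, rfl⟩
    simp only [Finset.mem_sigma, Finset.mem_product, Finset.mem_powerset]
    exact ⟨h1, mem_orderings.2 ⟨h2, rfl⟩, h3⟩
  · exact fun _ _ => rfl

end Orderings

/-! ### Weights of walks -/

section ChainWeight

variable {α R : Type*} [CommRing R]

/-- The product of `a x y` over all pairs of consecutive entries `x, y` of a list. -/
def chainWeight (a : α → α → R) : List α → R
  | [] => 1
  | [_] => 1
  | x :: y :: l => a x y * chainWeight a (y :: l)

lemma chainWeight_append_cons (a : α → α → R) (p : List α) (v : α) (s : List α) :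
    chainWeight a (p ++ v :: s) = chainWeight a (p ++ [v]) * chainWeight a (v :: s) := by
  induction p with
  | nil => simp [chainWeight]
  | cons x p ih =>
    cases p with
    | nil => simp [chainWeight]
    | cons y p =>
      simp only [List.cons_append, chainWeight] at ih ⊢
      rw [ih, mul_assoc]

lemma chainWeight_neg (a : α → α → R) (x : α) (l : List α) :
    chainWeight (fun x y => -a x y) (x :: l) = (-1) ^ l.length * chainWeight a (x :: l) := by
  induction l generalizing x with
  | nil => simp [chainWeight]
  | cons y l ih =>
    rw [chainWeight, ih, chainWeight, List.length_cons, pow_succ]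
    ring

open scoped Classical in
lemma chainWeight_indicator (r : α → α → Prop) (l : List α) :
    chainWeight (fun x y => if r x y then (1 : R) else 0) l = if l.IsChain r then 1 else 0 := by
  induction l with
  | nil => simp [chainWeight]
  | cons x l ih =>
    cases l with
    | nil => simp [chainWeight]
    | cons y l =>
      rw [chainWeight, ih]
      by_cases h : r x y <;> simp [h, List.isChain_cons_cons]

variable {a b : α → α → R}

/-- Telescoping: the difference of two products is a sum over the steps of the walk, with weights
`a` before the step and `b` after it. The step itself contributes `a - b = 1`, which is why it is
absent. -/
lemma chainWeight_cons_concat_sub (hab : ∀ x y, a x y = b x y + 1) (x : α) (t : List α) (v : α) :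
    chainWeight a (x :: (t ++ [v])) - chainWeight b (x :: (t ++ [v])) =
      cutSum (fun s e => chainWeight a (x :: s) * chainWeight b (e ++ [v])) t := by
  induction t generalizing x with
  | nil => simp [cutSum_nil, chainWeight, hab]
  | cons y t ih =>
    have hc : cutSum (fun s e => chainWeight a (x :: y :: s) * chainWeight b (e ++ [v])) t =
        a x y * cutSum (fun s e => chainWeight a (y :: s) * chainWeight b (e ++ [v])) t := by
      simp only [cutSum, Finset.mul_sum, chainWeight, mul_assoc]
    rw [cutSum_cons, hc, ← ih]
    simp only [List.cons_append, chainWeight, hab x y]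
    ring

/-- The cut with `q = []` gives the product of the `b` weights, the other cuts the telescoping
difference. -/
lemma chainWeight_concat (hab : ∀ x y, a x y = b x y + 1) (p : List α) (v : α) :
    chainWeight a (p ++ [v]) =
      cutSum (fun q e => chainWeight a q * chainWeight b (e ++ [v])) p := by
  cases p with
  | nil => simp [cutSum_nil, chainWeight]
  | cons x t =>
    rw [cutSum_cons, ← chainWeight_cons_concat_sub hab]
    simp [chainWeight]

/-- Write an ordering as `p v s` and expand the walk `p v` by telescoping into `q` with weights `a`
and `e v` with weights `b`. Placing `e v` after `v s` gives a closed walk through `v` cut at one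
step, and the sum over such cuts telescopes to the difference of the two closed weights. The list
`q` orders the remaining vertices. -/
lemma sum_chainWeight_insert [DecidableEq α] (hab : ∀ x y, a x y = b x y + 1)
    {v : α} {X : Finset α} (hv : v ∉ X) :
    ∑ w ∈ orderings (insert v X), chainWeight a w =
      ∑ Y ∈ X.powerset,
        (∑ t ∈ orderings Y, chainWeight a (v :: (t ++ [v])) -
          ∑ t ∈ orderings Y, chainWeight b (v :: (t ++ [v]))) *
        ∑ w ∈ orderings (X \ Y), chainWeight a w := by
  let H : Finset α → R := fun Y => ∑ w ∈ orderings Y, chainWeight a w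
  let S : Finset α → R := fun Y => ∑ s ∈ orderings Y, chainWeight a (v :: s)
  let E : Finset α → R := fun Y => ∑ e ∈ orderings Y, chainWeight b (e ++ [v])
  have h1 : ∀ Y, ∑ p ∈ orderings Y, chainWeight a (p ++ [v]) =
      ∑ Z ∈ Y.powerset, H Z * E (Y \ Z) := by
    intro Y
    simp only [chainWeight_concat hab, sum_orderings_cutSum, H, E, Finset.sum_mul_sum]
  have h2 : ∀ Y, ∑ t ∈ orderings Y, chainWeight a (v :: (t ++ [v])) -
      ∑ t ∈ orderings Y, chainWeight b (v :: (t ++ [v])) = ∑ Z ∈ Y.powerset, S Z * E (Y \ Z) := by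
    intro Y
    rw [← Finset.sum_sub_distrib]
    simp only [chainWeight_cons_concat_sub hab, sum_orderings_cutSum, S, E, Finset.sum_mul_sum]
  simp only [h2]
  rw [sum_orderings_insert _ hv]
  have h3 : ∀ Y, ∑ p ∈ orderings Y, ∑ s ∈ orderings (X \ Y), chainWeight a (p ++ v :: s) =
      ∑ Z ∈ Y.powerset, H Z * E (Y \ Z) * S (X \ Y) := by
    intro Y
    rw [← Finset.sum_mul, ← h1, Finset.sum_mul_sum]
    exact Finset.sum_congr rfl fun p _ => Finset.sum_congr rfl fun s _ =>
      chainWeight_append_cons a p v s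
  simp only [h3]
  -- Both sides become sums over splittings of `X` into the vertex sets of `q`, `e` and `s`, with
  -- the set of `q` outermost.
  rw [sum_powerset_powerset (fun A B C => H A * E B * S C),
    sum_powerset_sdiff_comm (fun Y Y' => (∑ Z ∈ Y.powerset, S Z * E (Y \ Z)) * H Y')]
  refine Finset.sum_congr rfl fun Y _ => ?_
  rw [sum_powerset_sdiff_comm (fun Z Z' => H Y * E Z * S Z'), Finset.sum_mul]
  exact Finset.sum_congr rfl fun Z _ => by ring

end ChainWeight

/-! ### Hamiltonian paths and cycles of induced subgraphs -/

section Counts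

variable {n : ℕ} (D : Digraph (Fin n))

noncomputable instance : Fintype (DiPath D) := Fintype.ofFinite _

noncomputable instance : Fintype (DiCycle D) := Fintype.ofFinite _

open scoped Classical in
/-- The `0`-`1` adjacency function of a digraph. -/
noncomputable def adjWeight (x y : Fin n) : ℚ := if D.Adj x y then 1 else 0

/-- The number of Hamiltonian paths of the subgraph induced on `X` (one if `X` is empty). -/
noncomputable def hamCount (X : Finset (Fin n)) : ℚ :=
  ∑ w ∈ orderings X, chainWeight (adjWeight D) w

/-- The number of cycles with vertex set `B`. -/
noncomputable def cycCount (B : Finset (Fin n)) : ℚ :=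
  (Finset.univ.filter fun c : DiCycle D => c.1.toFinset = B).card

lemma hamCount_empty : hamCount D ∅ = 1 := by
  simp [hamCount, orderings_empty, chainWeight]

/-- Nonemptiness matters: the empty ordering has weight `1`, but no `DiPath` is empty. -/
lemma hamCount_eq_card {X : Finset (Fin n)} (hX : X.Nonempty) :
    hamCount D X = (Finset.univ.filter fun l : DiPath D => l.1.toFinset = X).card := by
  classical
  unfold hamCount adjWeight
  simp only [chainWeight_indicator]
  rw [Finset.sum_boole]
  congr 1
  symm
  refine Finset.card_bij (fun l _ => l.1) ?_ ?_ ?_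
  · rintro ⟨l, hl⟩ h
    simp only [Finset.mem_filter, Finset.mem_univ, true_and] at h
    simp only [Finset.mem_filter, mem_orderings]
    exact ⟨⟨hl.1, h⟩, hl.2.2⟩
  · intro l _ l' _ h
    exact Subtype.ext h
  · intro l hl
    simp only [Finset.mem_filter, mem_orderings] at hl
    obtain ⟨⟨hn, rfl⟩, hc⟩ := hl
    refine ⟨⟨l, hn, ?_, hc⟩, by simp, rfl⟩
    rintro rfl
    simp at hX

/-- Without repetitions, only the trivial rotation keeps `v` in front; hence a cycle through `v` has
a unique linear form starting at `v`. -/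
lemma eq_of_isRotated_cons {α : Type*} {v : α} {t t' : List α} (hn : (v :: t).Nodup)
    (h : (v :: t) ~r (v :: t')) : t = t' := by
  obtain ⟨k, hk, h⟩ := List.isRotated_iff_mod.1 h
  rcases hk.lt_or_eq with hk | rfl
  · have h1 := congrArg List.head? h
    rw [List.head?_rotate hk, List.head?_cons, List.getElem?_eq_getElem hk,
      Option.some_inj] at h1
    have h0 : (v :: t)[k] = (v :: t)[0] := h1
    rw [hn.getElem_inj_iff] at h0
    subst h0
    simpa using h
  · simpa using h

/-- Each cycle is opened at `v`. A loop corresponds to `t = []`. -/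
lemma cycCount_insert {v : Fin n} {Y : Finset (Fin n)} (hv : v ∉ Y) :
    cycCount D (insert v Y) =
      ∑ t ∈ orderings Y, chainWeight (adjWeight D) (v :: (t ++ [v])) := by
  classical
  unfold cycCount adjWeight
  simp only [chainWeight_indicator]
  rw [Finset.sum_boole]
  congr 1
  symm
  have hmem : ∀ t, t ∈ (orderings Y).filter (fun t => (v :: (t ++ [v])).IsChain D.Adj) →
      v ∉ t ∧ t.Nodup ∧ t.toFinset = Y ∧ (v :: (t ++ [v])).IsChain D.Adj := by
    intro t ht
    simp only [Finset.mem_filter, mem_orderings] at ht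
    refine ⟨fun h => hv ?_, ht.1.1, ht.1.2, ht.2⟩
    rw [← ht.1.2, List.mem_toFinset]
    exact h
  refine Finset.card_bij (fun t ht => ⟨((v :: t : List (Fin n)) : Cycle (Fin n)),
    Cycle.nodup_coe_iff.2 (List.nodup_cons.2 ⟨(hmem t ht).1, (hmem t ht).2.1⟩),
    fun h => List.cons_ne_nil v t ((Cycle.coe_eq_nil _).1 h),
    (Cycle.chain_coe_cons _ _ _).2 (hmem t ht).2.2.2⟩) ?_ ?_ ?_
  · intro t ht
    simp [(hmem t ht).2.2.1]
  · intro t ht t' _ h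
    exact eq_of_isRotated_cons (List.nodup_cons.2 ⟨(hmem t ht).1, (hmem t ht).2.1⟩)
      (Cycle.coe_eq_coe.1 (Subtype.mk.inj h))
  · rintro ⟨c, hn, hne, hc⟩ h
    simp only [Finset.mem_filter, Finset.mem_univ, true_and] at h
    induction c using Quotient.inductionOn' with | _ l
    have hvl : v ∈ l := by
      rw [← List.mem_toFinset]
      exact h.ge (Finset.mem_insert_self _ _)
    obtain ⟨p, s, rfl⟩ := List.append_of_mem hvl
    have hrot : ((p ++ v :: s : List (Fin n)) : Cycle (Fin n)) =
        ((v :: (s ++ p) : List (Fin n)) : Cycle (Fin n)) :=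
      Cycle.coe_eq_coe.2 List.isRotated_append
    have hq : (Quotient.mk'' (p ++ v :: s) : Cycle (Fin n)) =
        ((v :: (s ++ p) : List (Fin n)) : Cycle (Fin n)) := hrot
    simp only [hq] at hn hc h
    rw [Cycle.nodup_coe_iff, List.nodup_cons] at hn
    rw [Cycle.chain_coe_cons] at hc
    rw [Cycle.coe_toFinset, List.toFinset_cons] at h
    refine ⟨s ++ p, ?_, Subtype.ext hq.symm⟩
    simp only [Finset.mem_filter, mem_orderings]
    refine ⟨⟨hn.2, ?_⟩, hc⟩
    rw [← Finset.erase_insert hv, ← h, Finset.erase_insert]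
    rw [List.mem_toFinset]
    exact hn.1

/-- The number of cycles of `D` minus the signed number of cycles of the complement of `D` with
vertex set `B`. -/
noncomputable def cycDiff (B : Finset (Fin n)) : ℚ :=
  cycCount D B - (-1) ^ B.card * cycCount Dᶜ B

lemma cycDiff_compl (B : Finset (Fin n)) : cycDiff Dᶜ B = -(-1) ^ B.card * cycDiff D B := by
  have h : ((-1 : ℚ) ^ B.card) * (-1) ^ B.card = 1 := by
    rw [← mul_pow]
    norm_num
  rw [cycDiff, cycDiff, compl_compl]
  linear_combination -cycCount Dᶜ B * h

/-- Every ordered pair, loops included, is an edge of exactly one of `D` and `Dᶜ`, so `a = 1_D` and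
`b = -1_{Dᶜ}` satisfy `a = b + 1`, and the closed walks through `v` count cycles. -/
lemma hamCount_insert {v : Fin n} {X : Finset (Fin n)} (hv : v ∉ X) :
    hamCount D (insert v X) =
      ∑ Y ∈ X.powerset, cycDiff D (insert v Y) * hamCount D (X \ Y) := by
  classical
  have hab : ∀ x y, adjWeight D x y = -adjWeight Dᶜ x y + 1 := by
    intro x y
    simp only [adjWeight, Digraph.compl_adj]
    by_cases h : D.Adj x y <;> simp [h]
  rw [hamCount, sum_chainWeight_insert hab hv]
  refine Finset.sum_congr rfl fun Y hY => ?_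
  have hvY : v ∉ Y := fun h => hv (Finset.mem_powerset.1 hY h)
  -- The closed walk `v t v` has as many steps as vertices, which gives the sign.
  have hneg : ∑ t ∈ orderings Y, chainWeight (fun x y => -adjWeight Dᶜ x y) (v :: (t ++ [v])) =
      (-1) ^ (insert v Y).card * cycCount Dᶜ (insert v Y) := by
    rw [cycCount_insert Dᶜ hvY, Finset.mul_sum]
    refine Finset.sum_congr rfl fun t ht => ?_
    obtain ⟨hn, rfl⟩ := mem_orderings.1 ht
    rw [chainWeight_neg, Finset.card_insert_of_notMem hvY, List.toFinset_card_of_nodup hn,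
      List.length_append, List.length_singleton]
  rw [hneg, cycDiff, cycCount_insert D hvY, hamCount]

lemma sum_cycDiff_mul_hamCount (v : Fin n) (X : Finset (Fin n)) :
    ∑ B ∈ X.powerset, (if v ∈ B then cycDiff D B else 0) * hamCount D (X \ B) =
      if v ∈ X then hamCount D X else 0 := by
  split_ifs with h
  · have hX : v ∉ X.erase v := Finset.notMem_erase v X
    conv_lhs => rw [← Finset.insert_erase h]
    rw [Finset.sum_powerset_insert hX, Finset.sum_eq_zero (s := (X.erase v).powerset), zero_add]
    · conv_rhs => rw [← Finset.insert_erase h, hamCount_insert D hX]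
      refine Finset.sum_congr rfl fun Y _ => ?_
      rw [if_pos (Finset.mem_insert_self _ _), Finset.insert_sdiff_insert,
        Finset.sdiff_insert_of_notMem]
      exact hX
    · intro Y hY
      rw [if_neg fun hvY => hX (Finset.mem_powerset.1 hY hvY), zero_mul]
  · refine Finset.sum_eq_zero fun B hB => ?_
    rw [if_neg fun hv => h (Finset.mem_powerset.1 hB hv), zero_mul]

end Counts

/-! ### Exact covers by blocks -/

section Covers

variable {V α : Type*} [DecidableEq V] [Fintype V] [Fintype α]

/-- The sets of blocks such that every element of `X` lies in the support of exactly one of the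
blocks, and every other element in none. -/
def exactCovers (s : α → Finset V) (X : Finset V) : Finset (Finset α) :=
  Finset.univ.filter fun T => ∀ v, (T.filter fun P => v ∈ s P).card = if v ∈ X then 1 else 0

variable {s : α → Finset V}

lemma mem_exactCovers {X : Finset V} {T : Finset α} : T ∈ exactCovers s X ↔
    ∀ v, (T.filter fun P => v ∈ s P).card = if v ∈ X then 1 else 0 := by
  simp [exactCovers]

lemma disjoint_of_mem_exactCovers_sdiff {X : Finset V} {P Q : α} {T : Finset α}
    (hT : T ∈ exactCovers s (X \ s P)) (hQ : Q ∈ T) : Disjoint (s P) (s Q) := by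
  rw [Finset.disjoint_left]
  intro v hvP hvQ
  have h := mem_exactCovers.1 hT v
  rw [if_neg (by simp [hvP]), Finset.card_eq_zero] at h
  exact Finset.notMem_empty Q (h ▸ Finset.mem_filter.2 ⟨hQ, hvQ⟩)

lemma notMem_of_mem_exactCovers_sdiff (hs : ∀ P, (s P).Nonempty) {X : Finset V} {P : α}
    {T : Finset α} (hT : T ∈ exactCovers s (X \ s P)) : P ∉ T := fun h =>
  (hs P).ne_empty (Finset.disjoint_self_iff_empty _ |>.1 (disjoint_of_mem_exactCovers_sdiff hT h))

lemma exactCovers_empty (hs : ∀ P, (s P).Nonempty) : exactCovers s ∅ = {∅} := by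
  ext T
  rw [Finset.mem_singleton, mem_exactCovers]
  constructor
  · intro h
    refine Finset.eq_empty_of_forall_notMem fun P hP => ?_
    obtain ⟨v, hv⟩ := hs P
    have h1 := h v
    rw [if_neg (Finset.notMem_empty v), Finset.card_eq_zero] at h1
    exact Finset.notMem_empty P (h1 ▸ Finset.mem_filter.2 ⟨hP, hv⟩)
  · rintro rfl v
    simp

variable [DecidableEq α]

lemma insert_mem_exactCovers {X : Finset V} {P : α} {T : Finset α} (hP : P ∉ T) :
    insert P T ∈ exactCovers s X ↔ s P ⊆ X ∧ T ∈ exactCovers s (X \ s P) := by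
  have hc : ∀ v, ((insert P T).filter fun Q => v ∈ s Q).card =
      (if v ∈ s P then 1 else 0) + (T.filter fun Q => v ∈ s Q).card := by
    intro v
    rw [Finset.filter_insert]
    split_ifs with h
    · rw [Finset.card_insert_of_notMem (fun h' => hP (Finset.mem_filter.1 h').1), add_comm]
    · rw [zero_add]
  simp only [mem_exactCovers, hc, Finset.mem_sdiff, Finset.subset_iff]
  rw [← forall_and]
  refine forall_congr' fun v => ?_
  by_cases h1 : v ∈ s P <;> by_cases h2 : v ∈ X <;> simp [h1, h2]

variable {M : Type*} [AddCommMonoid M]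

/-- A cover with a marked block is the same as a block together with a cover of the rest. Blocks
being nonempty ensures that the marked block is not already in the latter. -/
lemma sum_exactCovers_erase (hs : ∀ P, (s P).Nonempty) (G : α → Finset α → M) (X : Finset V) :
    ∑ T ∈ exactCovers s X, ∑ P ∈ T, G P (T.erase P) =
      ∑ P with s P ⊆ X, ∑ T ∈ exactCovers s (X \ s P), G P T := by
  rw [Finset.sum_sigma', Finset.sum_sigma']
  refine Finset.sum_bij' (fun x _ => ⟨x.2, x.1.erase x.2⟩) (fun x _ => ⟨insert x.1 x.2, x.1⟩)
    ?_ ?_ ?_ ?_ ?_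
  · rintro ⟨T, P⟩ h
    simp only [Finset.mem_sigma, Finset.mem_filter, Finset.mem_univ, true_and] at h ⊢
    rw [← insert_mem_exactCovers (Finset.notMem_erase P T), Finset.insert_erase h.2]
    exact h.1
  · rintro ⟨P, T⟩ h
    simp only [Finset.mem_sigma, Finset.mem_filter, Finset.mem_univ, true_and] at h ⊢
    exact ⟨(insert_mem_exactCovers (notMem_of_mem_exactCovers_sdiff hs h.2)).2 h,
      Finset.mem_insert_self _ _⟩
  · rintro ⟨T, P⟩ h
    simp only [Finset.mem_sigma] at h
    simp only [Finset.insert_erase h.2]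
  · rintro ⟨P, T⟩ h
    simp only [Finset.mem_sigma] at h
    simp only [Finset.erase_insert (notMem_of_mem_exactCovers_sdiff hs h.2)]
  · rintro ⟨T, P⟩ _
    rfl

/-- Exactly one block contains `v`, so marking that block introduces no multiplicity. -/
lemma sum_exactCovers_of_mem (hs : ∀ P, (s P).Nonempty) (G : α → Finset α → M) (F : Finset α → M)
    (hFG : ∀ T, ∀ P ∈ T, F T = G P (T.erase P)) {X : Finset V} {v : V} (hv : v ∈ X) :
    ∑ T ∈ exactCovers s X, F T =
      ∑ P with s P ⊆ X, if v ∈ s P then ∑ T ∈ exactCovers s (X \ s P), G P T else 0 := by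
  have h : ∀ P, (if v ∈ s P then ∑ T ∈ exactCovers s (X \ s P), G P T else 0) =
      ∑ T ∈ exactCovers s (X \ s P), if v ∈ s P then G P T else 0 := by
    intro P
    split_ifs <;> simp
  simp only [h]
  rw [← sum_exactCovers_erase hs (fun P T => if v ∈ s P then G P T else 0)]
  refine Finset.sum_congr rfl fun T hT => ?_
  have hc := mem_exactCovers.1 hT v
  rw [if_pos hv] at hc
  obtain ⟨P, hP⟩ := Finset.card_eq_one.1 hc
  rw [← Finset.sum_filter, hP, Finset.sum_singleton]
  have hPT : P ∈ T.filter fun P => v ∈ s P := hP ▸ Finset.mem_singleton_self P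
  exact hFG T P (Finset.mem_filter.1 hPT).1

end Covers

/-! ### Path-cycle covers of induced subgraphs -/

section Blocks

variable {n : ℕ} (D : Digraph (Fin n))

noncomputable instance : DecidableEq (DiPath D ⊕ DiCycle D) := Classical.decEq _

variable {D} in
/-- The vertex set of a path or cycle. -/
def blockSupport : DiPath D ⊕ DiCycle D → Finset (Fin n) :=
  Sum.elim (fun l => l.1.toFinset) fun c => c.1.toFinset

variable {D} in
/-- The pair of partitions given by the number of vertices of a single path or cycle. -/
def blockType : DiPath D ⊕ DiCycle D → Multiset ℕ × Multiset ℕ :=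
  Sum.elim (fun l => ({l.1.toFinset.card}, 0)) fun c => (0, {c.1.toFinset.card})

variable {D} in
/-- The pair of partitions given by the numbers of vertices of the paths and of the cycles in a set
of paths and cycles. -/
def coverType (T : Finset (DiPath D ⊕ DiCycle D)) : Multiset ℕ × Multiset ℕ :=
  ∑ P ∈ T, blockType P

/-- The tensor `m̃_λ ⊗ p_μ` of a pair of partitions. -/
noncomputable def tensorOfType (t : Multiset ℕ × Multiset ℕ) : SymFun ⊗[ℚ] SymFun :=
  augmentedMSym t.1 ⊗ₜ[ℚ] pSymPart t.2

/-- The path-cycle symmetric function of the subgraph induced on `X`. -/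
noncomputable def XiOn (X : Finset (Fin n)) : SymFun ⊗[ℚ] SymFun :=
  ∑ T ∈ exactCovers (blockSupport (D := D)) X, tensorOfType (coverType T)

variable {D}

lemma blockSupport_nonempty (P : DiPath D ⊕ DiCycle D) : (blockSupport P).Nonempty := by
  rw [Finset.nonempty_iff_ne_empty]
  rcases P with ⟨l, -, hl, -⟩ | ⟨c, -, hc, -⟩
  · exact fun h => hl (List.toFinset_eq_empty_iff _ |>.1 h)
  · exact fun h => hc (Cycle.toFinset_eq_nil.1 h)

lemma coverType_erase {T : Finset (DiPath D ⊕ DiCycle D)} {P : DiPath D ⊕ DiCycle D}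
    (hP : P ∈ T) : coverType T = blockType P + coverType (T.erase P) :=
  (Finset.add_sum_erase T blockType hP).symm

lemma zero_notMem_coverType (T : Finset (DiPath D ⊕ DiCycle D)) : 0 ∉ (coverType T).1 := by
  rw [coverType, Prod.fst_sum, Multiset.mem_sum]
  rintro ⟨P, -, hP⟩
  rcases P with l | c
  · have h := Finset.card_pos.2 (blockSupport_nonempty (Sum.inl l : DiPath D ⊕ DiCycle D))
    exact h.ne (Multiset.mem_singleton.1 hP)
  · exact Multiset.notMem_zero _ hP

lemma pSym_mul_tensorOfType {k : ℕ} (hk : k ≠ 0) {t : Multiset ℕ × Multiset ℕ} (ht : 0 ∉ t.1) :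
    (pSym k ⊗ₜ[ℚ] (1 : SymFun)) * tensorOfType t = tensorOfType (({k}, 0) + t) +
      (t.1.map fun j => tensorOfType ({j + k} + t.1.erase j, t.2)).sum := by
  rw [tensorOfType, Algebra.TensorProduct.tmul_mul_tmul, one_mul, pSym_mul_augmentedMSym hk ht,
    TensorProduct.add_tmul]
  congr 1
  · simp [tensorOfType, Multiset.singleton_add]
  · have := map_multiset_sum ((TensorProduct.mk ℚ SymFun SymFun).flip (pSymPart t.2))
      (t.1.map fun j => augmentedMSym ((j + k) ::ₘ t.1.erase j))
    rw [Multiset.map_map] at this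
    simpa [tensorOfType, Multiset.singleton_add, Function.comp_def] using this

lemma tensorOfType_add_cycle (k : ℕ) (t : Multiset ℕ × Multiset ℕ) :
    tensorOfType ((0, {k}) + t) = ((1 : SymFun) ⊗ₜ[ℚ] pSym k) * tensorOfType t := by
  rw [tensorOfType, tensorOfType, Algebra.TensorProduct.tmul_mul_tmul, one_mul]
  simp [pSymPart, Multiset.singleton_add]

/-- The parts of the path type are indexed by the paths of `T`, so the extra terms become a sum over
blocks to which cycles contribute nothing. The form with `T.erase P` fits `sum_exactCovers_erase`.
-/
lemma pSym_mul_tensorOfType_coverType {k : ℕ} (hk : k ≠ 0) (T : Finset (DiPath D ⊕ DiCycle D)) :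
    (pSym k ⊗ₜ[ℚ] (1 : SymFun)) * tensorOfType (coverType T) =
      tensorOfType (({k}, 0) + coverType T) +
      ∑ P ∈ T, Sum.elim
        (fun l => tensorOfType (({k + l.1.toFinset.card}, 0) + coverType (T.erase P)))
        (fun _ => 0) P := by
  rw [pSym_mul_tensorOfType hk (zero_notMem_coverType T)]
  congr 1
  have h : ∀ f : ℕ → SymFun ⊗[ℚ] SymFun, ((coverType T).1.map f).sum =
      ∑ P ∈ T, ((blockType P).1.map f).sum := by
    intro f
    rw [coverType, Prod.fst_sum]
    exact map_sum (Multiset.sumAddMonoidHom.comp (Multiset.mapAddMonoidHom f)) _ _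
  rw [h]
  refine Finset.sum_congr rfl fun P hP => ?_
  rw [coverType_erase hP]
  rcases P with l | c
  · simp [blockType, add_comm k, tensorOfType, Multiset.singleton_add]
  · simp [blockType]

/-- Paths are grouped by vertex set. The empty set is excluded explicitly because its `hamCount` is
`1`. -/
lemma sum_paths (X : Finset (Fin n)) (g : Finset (Fin n) → SymFun ⊗[ℚ] SymFun) :
    ∑ l : DiPath D, (if l.1.toFinset ⊆ X then g l.1.toFinset else 0) =
      ∑ B ∈ X.powerset, if B.Nonempty then hamCount D B • g B else 0 := by
  rw [← Finset.sum_filter, ← Finset.sum_fiberwise_of_maps_to (t := X.powerset)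
    (g := fun l : DiPath D => l.1.toFinset)]
  · refine Finset.sum_congr rfl fun B hB => ?_
    have h : (Finset.univ.filter fun l : DiPath D => l.1.toFinset ⊆ X).filter
        (fun l => l.1.toFinset = B) = Finset.univ.filter fun l => l.1.toFinset = B := by
      ext l
      simp only [Finset.mem_filter, Finset.mem_univ, true_and, and_iff_right_iff_imp]
      rintro rfl
      exact Finset.mem_powerset.1 hB
    rw [h, Finset.sum_congr rfl (g := fun _ => g B) fun l hl => by
      rw [(Finset.mem_filter.1 hl).2], Finset.sum_const]
    split_ifs with hne
    · rw [hamCount_eq_card D hne, Nat.cast_smul_eq_nsmul]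
    · rw [Finset.card_eq_zero.2, zero_smul]
      refine Finset.filter_eq_empty_iff.2 fun l _ hl => hne ?_
      rw [← hl]
      exact blockSupport_nonempty (Sum.inl l : DiPath D ⊕ DiCycle D)
  · intro l hl
    exact Finset.mem_powerset.2 (Finset.mem_filter.1 hl).2

lemma sum_cycles (X : Finset (Fin n)) (g : Finset (Fin n) → SymFun ⊗[ℚ] SymFun) :
    ∑ c : DiCycle D, (if c.1.toFinset ⊆ X then g c.1.toFinset else 0) =
      ∑ B ∈ X.powerset, cycCount D B • g B := by
  rw [← Finset.sum_filter, ← Finset.sum_fiberwise_of_maps_to (t := X.powerset)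
    (g := fun c : DiCycle D => c.1.toFinset)]
  · refine Finset.sum_congr rfl fun B hB => ?_
    have h : (Finset.univ.filter fun c : DiCycle D => c.1.toFinset ⊆ X).filter
        (fun c => c.1.toFinset = B) = Finset.univ.filter fun c => c.1.toFinset = B := by
      ext l
      simp only [Finset.mem_filter, Finset.mem_univ, true_and, and_iff_right_iff_imp]
      rintro rfl
      exact Finset.mem_powerset.1 hB
    rw [h, Finset.sum_congr rfl (g := fun _ => g B) fun c hc => by
      rw [(Finset.mem_filter.1 hc).2], Finset.sum_const, cycCount, Nat.cast_smul_eq_nsmul]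
  · intro c hc
    exact Finset.mem_powerset.2 (Finset.mem_filter.1 hc).2

/-! ### The recursion for path-cycle covers -/

variable (D) in
/-- The contribution to `XiOn D X` of the covers that contain a fixed path with vertex set `B`. -/
noncomputable def pathRemainder (X B : Finset (Fin n)) : SymFun ⊗[ℚ] SymFun :=
  ∑ T ∈ exactCovers (blockSupport (D := D)) (X \ B), tensorOfType (({B.card}, 0) + coverType T)

/-- The factor `p_{|B|}` either adds a new part or lengthens a path on some `C`, which has the same
effect on the type as one path on `B ∪ C`. The convention `hamCount D ∅ = 1` makes the first case
the term `C = ∅`. -/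
lemma pSym_mul_XiOn_sdiff {X B : Finset (Fin n)} (hB : B.Nonempty) :
    (pSym B.card ⊗ₜ[ℚ] (1 : SymFun)) * XiOn D (X \ B) =
      ∑ C ∈ (X \ B).powerset, hamCount D C • pathRemainder D X (B ∪ C) := by
  have hk : B.card ≠ 0 := (Finset.card_pos.2 hB).ne'
  rw [XiOn, Finset.mul_sum]
  simp only [pSym_mul_tensorOfType_coverType hk]
  rw [Finset.sum_add_distrib, sum_exactCovers_erase blockSupport_nonempty
    (fun P T => Sum.elim
        (fun l => tensorOfType (({B.card + l.1.toFinset.card}, 0) + coverType T)) (fun _ => 0) P),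
    Finset.sum_filter, Fintype.sum_sum_type]
  have hpath := sum_paths (D := D) (X \ B) fun C =>
    ∑ T ∈ exactCovers (blockSupport (D := D)) ((X \ B) \ C),
      tensorOfType (({B.card + C.card}, 0) + coverType T)
  simp only [Sum.elim_inl, Sum.elim_inr, Finset.sum_const_zero, ite_self, add_zero]
  refine (congrArg _ hpath).trans ?_
  have h0 : (∅ : Finset (Fin n)) ∈ (X \ B).powerset := Finset.empty_mem_powerset _
  rw [← Finset.add_sum_erase _ _ h0, ← Finset.add_sum_erase _ _ h0, if_neg Finset.not_nonempty_empty,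
    zero_add, hamCount_empty, one_smul, Finset.union_empty]
  refine congrArg _ (Finset.sum_congr rfl fun C hC => ?_)
  rw [Finset.mem_erase, Finset.mem_powerset] at hC
  have hd : Disjoint B C := Finset.disjoint_of_subset_right hC.2 Finset.disjoint_sdiff
  rw [if_pos (Finset.nonempty_iff_ne_empty.2 hC.1), pathRemainder, Finset.card_union_of_disjoint hd,
    sdiff_sdiff, Finset.sup_eq_union]

/-- The covers are sorted by the block containing `v`. A cycle factors out; a path does not, because
augmented monomial functions are not multiplicative. -/
lemma XiOn_eq_sum_pathRemainder {X : Finset (Fin n)} {v : Fin n} (hv : v ∈ X) :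
    XiOn D X = ∑ B ∈ X.powerset, ((if v ∈ B then hamCount D B else 0) • pathRemainder D X B +
      (if v ∈ B then cycCount D B else 0) •
        (((1 : SymFun) ⊗ₜ[ℚ] pSym B.card) * XiOn D (X \ B))) := by
  rw [XiOn, sum_exactCovers_of_mem blockSupport_nonempty
    (fun P T => tensorOfType (blockType P + coverType T)) _
    (fun T P hP => by rw [coverType_erase hP]) hv, Finset.sum_filter, Fintype.sum_sum_type]
  have hpath := sum_paths (D := D) X fun B => if v ∈ B then pathRemainder D X B else 0
  have hcyc := sum_cycles (D := D) X fun B => if v ∈ B then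
    ((1 : SymFun) ⊗ₜ[ℚ] pSym B.card) * XiOn D (X \ B) else 0
  rw [Finset.sum_add_distrib]
  refine congrArg₂ (· + ·) (hpath.trans ?_) (Eq.trans ?_ (hcyc.trans ?_))
  · refine Finset.sum_congr rfl fun B _ => ?_
    by_cases h : v ∈ B
    · have hB : B.Nonempty := ⟨v, h⟩
      simp [h, hB]
    · simp [h]
  · refine Finset.sum_congr rfl fun c _ => ?_
    simp only [XiOn, Finset.mul_sum, ← tensorOfType_add_cycle]
    rfl
  · refine Finset.sum_congr rfl fun B _ => ?_
    by_cases h : v ∈ B <;> simp [h]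

/-- Only the path terms need work. Expanding each `p_{|B|}` product by `pSym_mul_XiOn_sdiff` and
collecting the terms with `B ∪ C = Y`, the coefficient of the remainder of `Y` is the sum evaluated
by `sum_cycDiff_mul_hamCount`. -/
lemma XiOn_eq_sum {X : Finset (Fin n)} {v : Fin n} (hv : v ∈ X) :
    XiOn D X = ∑ B ∈ X.powerset, (if v ∈ B then
      cycDiff D B • (pSym B.card ⊗ₜ[ℚ] (1 : SymFun)) +
        cycCount D B • ((1 : SymFun) ⊗ₜ[ℚ] pSym B.card) else 0) * XiOn D (X \ B) := by
  rw [XiOn_eq_sum_pathRemainder hv, Finset.sum_add_distrib]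
  have hsplit : ∀ B, (if v ∈ B then cycDiff D B • (pSym B.card ⊗ₜ[ℚ] (1 : SymFun)) +
        cycCount D B • ((1 : SymFun) ⊗ₜ[ℚ] pSym B.card) else 0) * XiOn D (X \ B) =
      (if v ∈ B then cycDiff D B else 0) • ((pSym B.card ⊗ₜ[ℚ] (1 : SymFun)) * XiOn D (X \ B)) +
      (if v ∈ B then cycCount D B else 0) •
        (((1 : SymFun) ⊗ₜ[ℚ] pSym B.card) * XiOn D (X \ B)) := by
    intro B
    split_ifs
    · rw [add_mul, smul_mul_assoc, smul_mul_assoc]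
    · simp
  simp only [hsplit]
  rw [Finset.sum_add_distrib]
  congr 1
  have h1 : ∀ B ∈ X.powerset, (if v ∈ B then cycDiff D B else 0) •
      ((pSym B.card ⊗ₜ[ℚ] (1 : SymFun)) * XiOn D (X \ B)) =
      ∑ C ∈ (X \ B).powerset, ((if v ∈ B then cycDiff D B else 0) * hamCount D C) •
        pathRemainder D X (B ∪ C) := by
    intro B _
    by_cases h : v ∈ B
    · rw [pSym_mul_XiOn_sdiff ⟨v, h⟩, Finset.smul_sum]
      simp only [mul_smul]
    · simp [h]
  rw [Finset.sum_congr rfl h1, ← sum_powerset_powerset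
    (fun B C _ => ((if v ∈ B then cycDiff D B else 0) * hamCount D C) • pathRemainder D X (B ∪ C))]
  refine Finset.sum_congr rfl fun Y _ => ?_
  rw [← sum_cycDiff_mul_hamCount D v Y, Finset.sum_smul]
  refine Finset.sum_congr rfl fun B hB => ?_
  rw [Finset.union_sdiff_of_subset (Finset.mem_powerset.1 hB)]

lemma XiOn_empty : XiOn D ∅ = 1 := by
  have h : mSym 0 = 1 := eSym_zero
  rw [XiOn, exactCovers_empty blockSupport_nonempty, Finset.sum_singleton, coverType,
    Finset.sum_empty, tensorOfType, Algebra.TensorProduct.one_def]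
  simp [augmentedMSym, pSymPart, h]

variable (D) in
lemma XiOn_univ : XiOn D Finset.univ = Xi D := by
  classical
  symm
  have hcard : ∀ (p : Finset (DiPath D)) (c : Finset (DiCycle D)) (v : Fin n),
      ((p.disjSum c).filter fun P => v ∈ blockSupport P).card =
        (p.filter fun l => v ∈ l.1).card + (c.filter fun c => v ∈ c.1).card := by
    intro p c v
    have : (p.disjSum c).filter (fun P => v ∈ blockSupport P) =
        (p.filter fun l => v ∈ l.1).disjSum (c.filter fun c => v ∈ c.1) := by
      ext P
      rcases P with l | ⟨c', h⟩
      · rw [Finset.mem_filter, Finset.inl_mem_disjSum, Finset.inl_mem_disjSum, Finset.mem_filter]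
        exact and_congr_right fun _ => List.mem_toFinset
      · rw [Finset.mem_filter, Finset.inr_mem_disjSum, Finset.inr_mem_disjSum, Finset.mem_filter]
        induction c' using Quotient.inductionOn' with | _ l
        exact and_congr_right fun _ => List.mem_toFinset
    rw [this, Finset.card_disjSum]
  refine Finset.sum_bij (fun S _ => S.paths.disjSum S.cycles) ?_ ?_ ?_ ?_
  · intro S _
    rw [mem_exactCovers]
    intro v
    rw [hcard, S.covers, if_pos (Finset.mem_univ v)]
  · rintro ⟨p, c, h⟩ _ ⟨p', c', h'⟩ _ heq
    have h1 := congrArg Finset.toLeft heq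
    have h2 := congrArg Finset.toRight heq
    simp only [Finset.toLeft_disjSum, Finset.toRight_disjSum] at h1 h2
    subst h1 h2
    rfl
  · intro T hT
    refine ⟨⟨T.toLeft, T.toRight, fun v => ?_⟩, Finset.mem_univ _, Finset.toLeft_disjSum_toRight⟩
    rw [← hcard, Finset.toLeft_disjSum_toRight, mem_exactCovers.1 hT, if_pos (Finset.mem_univ v)]
  · intro S _
    have hp : (coverType (S.paths.disjSum S.cycles)).1 = S.pathType := by
      rw [coverType, Prod.fst_sum, Finset.sum_disjSum]
      simp only [blockType, Sum.elim_inl, Sum.elim_inr, Finset.sum_const_zero, add_zero]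
      rw [PathCycleCover.pathType, ← Multiset.sum_map_singleton (S.paths.val.map _),
        Multiset.map_map]
      refine Finset.sum_congr rfl fun l _ => ?_
      -- `blockType` records the size of the vertex set, which is the length since vertices do not
      -- repeat.
      rw [List.toFinset_card_of_nodup l.2.1]
      rfl
    have hc : (coverType (S.paths.disjSum S.cycles)).2 = S.cycleType := by
      rw [coverType, Prod.snd_sum, Finset.sum_disjSum]
      simp only [blockType, Sum.elim_inl, Sum.elim_inr, Finset.sum_const_zero, zero_add]
      rw [PathCycleCover.cycleType, ← Multiset.sum_map_singleton (S.cycles.val.map _),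
        Multiset.map_map]
      refine Finset.sum_congr rfl fun c _ => ?_
      obtain ⟨c, hn, -⟩ := c
      induction c using Quotient.inductionOn' with | _ l
      exact congrArg _ (List.toFinset_card_of_nodup (Cycle.nodup_coe_iff.1 hn))
    rw [tensorOfType, hp, hc]

/-! ### Reciprocity -/

/-- All the maps are algebra homomorphisms, so both sides satisfy recursions at the same `v`, and it
suffices to match the factors attached to each `B`. -/
lemma replaceZByZY_omegaZ_negY_XiOn_compl (X : Finset (Fin n)) :
    replaceZByZY (omegaZ (negY (XiOn Dᶜ X))) = toSeries (XiOn D X) := by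
  induction X using Finset.strongInduction with
  | H X ih =>
    rcases X.eq_empty_or_nonempty with rfl | ⟨v, hv⟩
    · simp only [XiOn_empty, map_one]
    rw [XiOn_eq_sum (D := Dᶜ) hv, XiOn_eq_sum (D := D) hv]
    simp only [map_sum, map_mul]
    refine Finset.sum_congr rfl fun B hB => ?_
    by_cases h : v ∈ B
    · have hk : B.card ≠ 0 := (Finset.card_pos.2 ⟨v, h⟩).ne'
      rw [ih (X \ B) (Finset.sdiff_ssubset (Finset.mem_powerset.1 hB) ⟨v, h⟩), if_pos h, if_pos h]
      congr 1
      have hz : replaceZByZY (omegaZ (negY (pSym B.card ⊗ₜ[ℚ] (1 : SymFun)))) =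
          (-1 : ℚ) ^ (B.card + 1) • (inZ (pSym B.card) + inY (pSym B.card)) := by
        simp only [negY, omegaZ, replaceZByZY, Algebra.TensorProduct.map_tmul, map_one,
          Algebra.TensorProduct.productMap_apply_tmul, AlgHom.id_apply, omega_pSym hk, mul_one,
          map_mul, map_pow, map_neg, inZY_pSym hk]
        rw [Algebra.smul_def, map_pow, map_neg, map_one]
      have hy : replaceZByZY (omegaZ (negY ((1 : SymFun) ⊗ₜ[ℚ] pSym B.card))) =
          (-1 : ℚ) ^ B.card • inY (pSym B.card) := by
        simp only [negY, omegaZ, replaceZByZY, Algebra.TensorProduct.map_tmul, map_one,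
          Algebra.TensorProduct.productMap_apply_tmul, AlgHom.id_apply, negVars_pSym hk, one_mul,
          map_smul]
      have hz' : toSeries (pSym B.card ⊗ₜ[ℚ] (1 : SymFun)) = inZ (pSym B.card) := by
        simp [toSeries]
      have hy' : toSeries ((1 : SymFun) ⊗ₜ[ℚ] pSym B.card) = inY (pSym B.card) := by
        simp [toSeries]
      simp only [map_add, map_smul, hz, hy, hz', hy', cycDiff_compl, smul_smul]
      have hs : ((-1 : ℚ) ^ B.card) * (-1) ^ B.card = 1 := by
        rw [← mul_pow]
        norm_num
      have h1 : -(-1 : ℚ) ^ B.card * cycDiff D B * (-1) ^ (B.card + 1) = cycDiff D B := by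
        linear_combination cycDiff D B * hs
      -- The `y` term created by replacing `z` with `(z, y)` has coefficient `cycDiff D B`; this is
      -- exactly what turns the signed cycle count of `Dᶜ` into that of `D`.
      have h2 : cycCount D B = cycDiff D B + cycCount Dᶜ B * (-1) ^ B.card := by
        rw [cycDiff]
        ring
      rw [h1, h2, smul_add, add_smul, add_assoc]
    · simp [h]

end Blocks

end ChowPC

theorem theorem28 (n : ℕ) (D : Digraph (Fin n)) :
    ChowPC.replaceZByZY (ChowPC.omegaZ (ChowPC.negY (ChowPC.Xi Dᶜ))) =
      ChowPC.toSeries (ChowPC.Xi D) := by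
  rw [← ChowPC.XiOn_univ, ← ChowPC.XiOn_univ, ChowPC.replaceZByZY_omegaZ_negY_XiOn_compl]
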